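/- **Proposition.** Let $\mathsf T$ be a rigidly-compactly generated tensor-triangulated category: a triangulated category with small coproducts and a symmetric monoidal structure whose tensor product is exact and preserves coproducts in each variable, such that the compact objects coincide with the rigid (dualizable) objects, form an essentially small subcategory $\mathsf T^{\omega}$, and generate $\mathsf T$. Let $\mathrm{Prism}(\mathsf T^{\omega})$ be the Priestley space of the Balmer spectrum $\mathrm{Spc}(\mathsf T^{\omega})$, i.e. the set of prime thick tensor-ideals of $\mathsf T^\omega$ with the constructible topology and the specialization order, for which $\mathsf P\leqslant \mathsf Q$ if and only if $\mathsf P\subseteq \mathsf Q$. For an open down-set $W$ of $\mathrm{Prism}(\mathsf T^{\omega})$ let $\mathsf T(W)$ be the localizing ideal of $\mathsf T$ generated by the compact objects $a$ with $\operatorname{supp}(a)\subseteq W$, and let $\mathsf T(W^c)$ be its right-orthogonal. Then for all open down-sets $W$ and $V$ the inclusion $\mathsf T(W)\hookrightarrow \mathsf T$ has a right adjoint $\Gamma_W$ and the inclusion $\mathsf T(V^c)\hookrightarrow\mathsf T$ has a left adjoint $L_V$. If a point $x$ satisfies $\{x\}=W\cap V^c$ with open down-sets $W,V$, write $\Gamma_x=\Gamma_W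 L_V\colon \mathsf T\to\mathsf T$ and let $\Gamma_x\mathsf T$ be its essential image. Let $U\subseteq \mathrm{Prism}(\mathsf T^{\omega})$ be a set of points each of which is isolated and minimal. Then $U$ is an open down-set, every $x\in U$ has a presentation $\{x\}=W_x\cap V_x^c$ with open down-sets $W_x,V_x$, and for every choice of such presentations each $\Gamma_x\mathsf T$ is a triangulated subcategory of $\mathsf T$ and the canonical functor $$\mathsf T(U)\longrightarrow \prod_{x\in U}\Gamma_x\mathsf T,\qquad M\longmapsto (\Gamma_xM)_{x\in U},$$ is an equivalence of categories each of whose components $M\mapsto \Gamma_x M$ is exact. -/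

import Mathlib

open CategoryTheory CategoryTheory.Limits CategoryTheory.Pretriangulated MonoidalCategory Opposite

open scoped ZeroObject

universe v u

set_option linter.unusedSectionVars false

namespace TTGeometry

section Exactness

variable {C D : Type*} [Category* C] [Category* D] [HasZeroObject C] [HasZeroObject D]
  [HasShift C ℤ] [HasShift D ℤ] [Preadditive C] [Preadditive D]
  [∀ n : ℤ, (shiftFunctor C n).Additive] [∀ n : ℤ, (shiftFunctor D n).Additive]
  [Pretriangulated C] [Pretriangulated D]

/-- A functor between triangulated categories is exact if it can be equipped with isomorphisms
`F (X⟦n⟧) ≅ (F X)⟦n⟧` for which it preserves distinguished triangles. -/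
def IsExact (F : C ⥤ D) : Prop :=
  ∃ _ : F.CommShift ℤ, F.IsTriangulated

end Exactness

section Compact

variable (T : Type u) [Category.{v} T] [Preadditive T]

/-- The compact objects: `Hom(X, -)`, with values in abelian groups, preserves small coproducts. -/
def compactObjects : ObjectProperty T := fun X =>
  ∀ J : Type v, PreservesColimitsOfShape (Discrete J) (preadditiveCoyoneda.obj (op X))

end Compact

section Rigid

variable (T : Type u) [Category.{v} T] [MonoidalCategory T]

/-- The rigid (dualizable) objects of a monoidal category. The side on which the dual is taken is
irrelevant when the category is symmetric. -/
def rigidObjects : ObjectProperty T := fun X => ∃ Y : T, Nonempty (ExactPairing X Y)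

end Rigid

section

variable (T : Type u) [Category.{v} T] [Preadditive T] [HasZeroObject T] [HasShift T ℤ]
  [∀ n : ℤ, (shiftFunctor T n).Additive] [Pretriangulated T]
  [MonoidalCategory T] [SymmetricCategory T]

/-- A triangulated category with a symmetric monoidal structure is tensor-triangulated if the
tensor product is exact in each variable (by symmetry, one variable is enough). -/
class TensorTriangulated : Prop where
  exact_tensorLeft : ∀ X : T, IsExact (tensorLeft X)

/-- A tensor-triangulated category with small coproducts is rigidly-compactly generated if its
tensor product preserves coproducts in each variable, the compact objects and the rigid objects
are the same (in particular the unit is compact), there is essentially only a set of compact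
objects, and the compact objects generate. -/
class RigidlyCompactlyGenerated [HasCoproducts.{v} T] : Prop extends TensorTriangulated T where
  tensorLeft_preservesCoproducts : ∀ (X : T) (J : Type v),
    PreservesColimitsOfShape (Discrete J) (tensorLeft X)
  compact_iff_rigid : ∀ X : T, compactObjects T X ↔ rigidObjects T X
  essentiallySmall_compactObjects : ObjectProperty.EssentiallySmall.{v} (compactObjects T)
  isZero_of_forall_compact : ∀ X : T,
    (∀ a : T, compactObjects T a → ∀ f : a ⟶ X, f = 0) → IsZero X

/-- A point of the Balmer spectrum of the category of compact objects of `T`: a proper prime thick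
tensor-ideal of compact objects. -/
@[ext]
structure BalmerSpectrum where
  /-- the objects of the prime ideal -/
  carrier : ObjectProperty T
  le_compactObjects : carrier ≤ compactObjects T
  isTriangulated : carrier.IsTriangulated
  isStableUnderRetracts : carrier.IsStableUnderRetracts
  tensor_mem : ∀ a b : T, compactObjects T a → carrier b → carrier (a ⊗ b)
  exists_notMem : ∃ a : T, compactObjects T a ∧ ¬ carrier a
  mem_or_mem : ∀ a b : T, compactObjects T a → compactObjects T b →
    carrier (a ⊗ b) → carrier a ∨ carrier b

variable {T}

/-- The support of a compact object. -/
def supp (a : T) : Set (BalmerSpectrum T) := {P | ¬ P.carrier a}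

/-- The Zariski topology on the Balmer spectrum: the supports of the compact objects form a basis
of closed subsets. -/
instance : TopologicalSpace (BalmerSpectrum T) :=
  TopologicalSpace.generateFrom {s | ∃ a : T, compactObjects T a ∧ s = (supp a)ᶜ}

/-- The specialization relation on the Balmer spectrum is given by inclusion of prime ideals. -/
lemma specializes_iff {P Q : BalmerSpectrum T} : Q ⤳ P ↔ P.carrier ≤ Q.carrier := by
  rw [specializes_iff_forall_open]
  constructor
  · intro h a ha
    by_contra hQ
    exact h (supp a)ᶜ (TopologicalSpace.isOpen_generateFrom_of_mem
      ⟨a, P.le_compactObjects a ha, rfl⟩) (fun h' => h' ha) hQ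
  · intro h s hs
    induction hs with
    | basic s hs =>
      obtain ⟨a, -, rfl⟩ := hs
      intro hP hQ
      exact hP (fun ha => hQ (h a ha))
    | univ => exact fun _ => trivial
    | inter s t _ _ hs ht => exact fun hP => ⟨hs hP.1, ht hP.2⟩
    | sUnion S _ ih =>
      rintro ⟨s, hs, hP⟩
      exact ⟨s, hs, ih s hs hP⟩

instance : T0Space (BalmerSpectrum T) where
  t0 P Q h := by
    rw [inseparable_iff_specializes_and, specializes_iff, specializes_iff] at h
    exact BalmerSpectrum.ext (le_antisymm h.2 h.1)

variable (T) in
/-- The prism of the category of compact objects of `T`: the Priestley space attached to the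
Balmer spectrum. It has the same points, the constructible topology, and the specialization
order. -/
def Prism : Type u := BalmerSpectrum T

instance : TopologicalSpace (Prism T) := constructibleTopology (BalmerSpectrum T)

/-- The order `P ≤ Q` of the prism means that `P` lies in the Zariski closure of `Q`. -/
instance : PartialOrder (Prism T) := specializationOrder (BalmerSpectrum T)

lemma prism_le_iff {P Q : Prism T} :
    P ≤ Q ↔ BalmerSpectrum.carrier P ≤ BalmerSpectrum.carrier Q :=
  specializes_iff (P := P) (Q := Q)

/-- Open down-sets of the prism (equivalently, Thomason subsets of the Balmer spectrum). -/
def IsOpenDownSet (U : Set (Prism T)) : Prop := IsOpen U ∧ IsLowerSet U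

end

section Localizing

variable {T : Type u} [Category.{v} T] [Preadditive T] [HasZeroObject T] [HasShift T ℤ]
  [∀ n : ℤ, (shiftFunctor T n).Additive] [Pretriangulated T] [MonoidalCategory T]

/-- Localizing ideals: full (replete) triangulated subcategories that are closed under small
coproducts and under tensoring with arbitrary objects. -/
structure IsLocalizingIdeal (P : ObjectProperty T) : Prop where
  isTriangulated : P.IsTriangulated
  isClosedUnderIsomorphisms : P.IsClosedUnderIsomorphisms
  isClosedUnderCoproducts : ∀ J : Type v, P.IsClosedUnderColimitsOfShape (Discrete J)
  tensor_mem : ∀ X Y : T, P Y → P (X ⊗ Y)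

/-- The smallest localizing ideal containing a class of objects. -/
def localizingIdeal (S : ObjectProperty T) : ObjectProperty T := fun X =>
  ∀ P : ObjectProperty T, IsLocalizingIdeal P → S ≤ P → P X

lemma le_localizingIdeal (S : ObjectProperty T) : S ≤ localizingIdeal S :=
  fun _ hX _ _ hP => hP _ hX

lemma isLocalizingIdeal_localizingIdeal (S : ObjectProperty T) :
    IsLocalizingIdeal (localizingIdeal S) := by
  have iso : (localizingIdeal S).IsClosedUnderIsomorphisms := ⟨fun e hX P hP hS =>
    have := hP.isClosedUnderIsomorphisms
    P.prop_of_iso e (hX P hP hS)⟩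
  refine ⟨?_, iso, ?_, ?_⟩
  · have zero : (localizingIdeal S).ContainsZero := ⟨0, isZero_zero T, fun P hP _ =>
      have := hP.isTriangulated
      have := hP.isClosedUnderIsomorphisms
      P.prop_zero⟩
    have shift : (localizingIdeal S).IsStableUnderShift ℤ := ⟨fun n => ⟨fun X hX P hP hS =>
      have := hP.isTriangulated
      P.le_shift n _ (hX P hP hS)⟩⟩
    have ext : (localizingIdeal S).IsTriangulatedClosed₂ := .mk' (fun Δ hΔ h₁ h₃ P hP hS =>
      have := hP.isTriangulated
      have := hP.isClosedUnderIsomorphisms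
      P.ext_of_isTriangulatedClosed₂ Δ hΔ (h₁ P hP hS) (h₃ P hP hS))
    constructor
  · refine fun J => ⟨?_⟩
    rintro X ⟨c⟩ P hP hS
    have := hP.isClosedUnderCoproducts J
    exact P.prop_of_isColimit c.isColimit (fun j => c.prop_diag_obj j P hP hS)
  · exact fun X Y hY P hP hS => hP.tensor_mem X Y (hY P hP hS)

end Localizing

section Local

variable {T : Type u} [Category.{v} T] [Preadditive T] [HasZeroObject T] [HasShift T ℤ]
  [∀ n : ℤ, (shiftFunctor T n).Additive] [Pretriangulated T]
  [MonoidalCategory T] [SymmetricCategory T]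

/-- The torsion category `T(U)`: the localizing ideal generated by the compact objects whose
support is contained in `U`. -/
def torsion (U : Set (Prism T)) : ObjectProperty T :=
  localizingIdeal (fun a => compactObjects T a ∧ supp a ⊆ U)

instance (U : Set (Prism T)) : (torsion U).IsTriangulated :=
  (isLocalizingIdeal_localizingIdeal _).isTriangulated

/-- The local category `T(Uᶜ)`: the right-orthogonal of the torsion category `T(U)`. -/
def localAway (U : Set (Prism T)) : ObjectProperty T := (torsion U).rightOrthogonal

/-- The functor `Γ_U : T ⥤ T(U)`, right adjoint to the inclusion. -/
noncomputable def torsionFunctor (U : Set (Prism T)) (h : (torsion U).ι.IsLeftAdjoint) :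
    T ⥤ (torsion U).FullSubcategory :=
  (torsion U).ι.rightAdjoint

/-- The functor `L_V : T ⥤ T(Vᶜ)`, left adjoint to the inclusion. -/
noncomputable def localizationFunctor (V : Set (Prism T)) (h : (localAway V).ι.IsRightAdjoint) :
    T ⥤ (localAway V).FullSubcategory :=
  (localAway V).ι.leftAdjoint

/-- The endofunctor `Γ_W L_V` of `T`. It is `Γ_x` when `W` and `V` are open down-sets with
`W ∩ Vᶜ = {x}`, and its essential image is then the category `Γ_x T` of local factors at `x`. -/
noncomputable def pointFunctor (W V : Set (Prism T)) (hW : (torsion W).ι.IsLeftAdjoint)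
    (hV : (localAway V).ι.IsRightAdjoint) : T ⥤ T :=
  localizationFunctor V hV ⋙ (localAway V).ι ⋙ torsionFunctor W hW ⋙ (torsion W).ι

/-- The diagonal functor `T(U) ⥤ ∏_{x ∈ U} Γ_x T`, `M ↦ (Γ_x M)_x`, where
`Γ_x = Γ_{W x} L_{V x}` and `Γ_x T` is the essential image of `Γ_x`. -/
noncomputable def diagonalFunctor (U : Set (Prism T)) (W V : U → Set (Prism T))
    (hW : ∀ x, (torsion (W x)).ι.IsLeftAdjoint)
    (hV : ∀ x, (localAway (V x)).ι.IsRightAdjoint) :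
    (torsion U).FullSubcategory ⥤
      ∀ x : U, (pointFunctor (W x) (V x) (hW x) (hV x)).essImage.FullSubcategory :=
  Functor.pi' fun x => (torsion U).ι ⋙ (pointFunctor (W x) (V x) (hW x) (hV x)).toEssImage

end Local

end TTGeometry

open TTGeometry

/-! A minimal isolated point `x` is itself an open down-set, so `torsion {x}` is available. The
theorem rests on two facts: `Γ_x` is the colocalization onto `torsion {x}` whatever the presentation
of `x`, and an object of `T(U)` is the coproduct of its colocalizations at the points of `U`.

Both come from one mechanism. A map between torsion objects over `W` is invertible once it is
colocal for `torsion W`, which means that its cone is right-orthogonal to `torsion W`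
(`isColocal_eq_trW_rightOrthogonal`). This may be tested on compact objects supported in `W`
(`localAway_eq`), and it is local on the prism: by prime avoidance it suffices to test on the
members of a cover by open down-sets (`rightOrthogonal_supportedIn_of_subset_sUnion`). Moreover,
torsion objects over disjoint sets are orthogonal (`torsion_le_localAway`), since their compact
generators tensor to zero.

If `{x} = W ∩ Vᶜ`, then `W` is covered by the disjoint sets `{x}` and `V`. The cone of `Γ_{x} X ⟶ X
⟶ L_V X` is orthogonal to both parts, so this map exhibits `Γ_{x} X` as `Γ_W L_V X`
(`isColocal_counit_comp_unit`). Covering `U` by its points shows in the same way that `∐ Γ_x M ⟶ M`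
is invertible (`isIso_desc`). Maps out of `M` are then families of maps out of the `Γ_x M`, which
gives full faithfulness, and coproducts of families of local factors give essential surjectivity.

The adjoints exist by Bousfield colocalization at an essentially small class of compact objects
(`exists_isColocal`). -/

namespace TTGeometry

/-! ### Compactness as factorization through finite sums -/

section Compact

variable {T : Type u} [Category.{v} T] [Preadditive T]

open Classical in
/-- The projection of a coproduct onto one of its summands. -/
noncomputable def cofanProj {J : Type*} {F : J → T} {c : Cofan F} (hc : IsColimit c) (j : J) :
    c.pt ⟶ F j :=
  Cofan.IsColimit.desc hc fun i => if h : i = j then eqToHom (by rw [h]) else 0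

@[simp]
lemma inj_cofanProj_self {J : Type*} {F : J → T} {c : Cofan F} (hc : IsColimit c) (j : J) :
    c.inj j ≫ cofanProj hc j = 𝟙 _ := by
  simp [cofanProj, Cofan.IsColimit.fac]

lemma inj_cofanProj_of_ne {J : Type*} {F : J → T} {c : Cofan F} (hc : IsColimit c) {i j : J}
    (h : i ≠ j) : c.inj i ≫ cofanProj hc j = 0 := by
  simp [cofanProj, Cofan.IsColimit.fac, h]

/-- The group of those morphisms to the vertex of a cofan that are finite sums of morphisms
factoring through the summands. -/
def finiteSums {J : Type*} {F : J → T} (c : Cofan F) (X : T) : AddSubgroup (X ⟶ c.pt) :=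
  AddSubgroup.closure {f | ∃ (j : J) (g : X ⟶ F j), f = g ≫ c.inj j}

lemma comp_inj_mem_finiteSums {J : Type*} {F : J → T} (c : Cofan F) {X : T} {j : J}
    (g : X ⟶ F j) : g ≫ c.inj j ∈ finiteSums c X :=
  AddSubgroup.subset_closure ⟨j, g, rfl⟩

lemma comp_mem_finiteSums {J : Type*} {F : J → T} {c : Cofan F} {X Y : T} (h : X ⟶ Y)
    {f : Y ⟶ c.pt} (hf : f ∈ finiteSums c Y) : h ≫ f ∈ finiteSums c X := by
  induction hf using AddSubgroup.closure_induction with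
  | mem f hf =>
    obtain ⟨j, g, rfl⟩ := hf
    rw [← Category.assoc]
    exact comp_inj_mem_finiteSums c _
  | zero => simp [zero_mem]
  | add f g _ _ hf hg => rw [Preadditive.comp_add]; exact add_mem hf hg
  | neg f _ hf => rw [Preadditive.comp_neg]; exact neg_mem hf

/-- Additivity requires a common index set for two summands, so the induction proves the formula for
every finite set containing `s`. -/
lemma exists_finset_of_mem_finiteSums {J : Type*} {F : J → T} {c : Cofan F} (hc : IsColimit c)
    {X : T} {f : X ⟶ c.pt} (hf : f ∈ finiteSums c X) :
    ∃ s : Finset J, (∀ j ∉ s, f ≫ cofanProj hc j = 0) ∧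
      f = ∑ j ∈ s, f ≫ cofanProj hc j ≫ c.inj j := by
  classical
  suffices h : ∃ s : Finset J, ∀ t, s ⊆ t → f = ∑ j ∈ t, f ≫ cofanProj hc j ≫ c.inj j by
    obtain ⟨s, hs⟩ := h
    refine ⟨s, fun j hj => ?_, hs s subset_rfl⟩
    rw [hs s subset_rfl, Preadditive.sum_comp]
    refine Finset.sum_eq_zero fun i hi => ?_
    have : i ≠ j := fun h => hj (h ▸ hi)
    simp [inj_cofanProj_of_ne hc this]
  induction hf using AddSubgroup.closure_induction with
  | mem f hf =>
    obtain ⟨j, g, rfl⟩ := hf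
    refine ⟨{j}, fun t ht => ?_⟩
    rw [Finset.sum_eq_single j]
    · rw [Category.assoc, reassoc_of% (inj_cofanProj_self hc j)]
    · intro i _ hij
      rw [Category.assoc, reassoc_of% (inj_cofanProj_of_ne hc hij.symm)]
      simp
    · intro h
      exact (h (ht (Finset.mem_singleton_self j))).elim
  | zero => exact ⟨∅, fun t _ => by simp⟩
  | add f g _ _ hf hg =>
    obtain ⟨s, hs⟩ := hf
    obtain ⟨s', hs'⟩ := hg
    refine ⟨s ∪ s', fun t ht => ?_⟩
    simp only [Preadditive.add_comp, Finset.sum_add_distrib]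
    rw [← hs t (Finset.union_subset_left ht), ← hs' t (Finset.union_subset_right ht)]
  | neg f _ hf =>
    obtain ⟨s, hs⟩ := hf
    refine ⟨s, fun t ht => ?_⟩
    simp only [Preadditive.neg_comp, Finset.sum_neg_distrib]
    rw [← hs t ht]

lemma eq_zero_of_mem_finiteSums {J : Type*} {F : J → T} {c : Cofan F} (hc : IsColimit c)
    {X : T} {f : X ⟶ c.pt} (hf : f ∈ finiteSums c X) (h : ∀ j, f ≫ cofanProj hc j = 0) :
    f = 0 := by
  obtain ⟨s, -, hs⟩ := exists_finset_of_mem_finiteSums hc hf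
  rw [hs]
  exact Finset.sum_eq_zero fun j _ => by rw [← Category.assoc, h, zero_comp]

/-- The quotient map by the finite sums vanishes on every summand, hence is zero when `Hom(X, -)`
preserves the coproduct. -/
lemma mem_finiteSums_of_compactObjects {X : T} (hX : compactObjects T X) {J : Type v} {F : J → T}
    {c : Cofan F} (hc : IsColimit c) (f : X ⟶ c.pt) : f ∈ finiteSums c X := by
  have := hX J
  have hc' := isColimitOfPreserves (preadditiveCoyoneda.obj (op X)) hc
  let q : (preadditiveCoyoneda.obj (op X)).obj c.pt ⟶
      AddCommGrpCat.of ((X ⟶ c.pt) ⧸ finiteSums c X) :=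
    AddCommGrpCat.ofHom (QuotientAddGroup.mk' (finiteSums c X))
  have hq : q = 0 := by
    refine hc'.hom_ext fun j => ?_
    ext (g : X ⟶ F j.as)
    exact (QuotientAddGroup.eq_zero_iff _).2 (comp_inj_mem_finiteSums c g)
  have := ConcreteCategory.congr_hom hq f
  exact (QuotientAddGroup.eq_zero_iff f).1 this

/-- A cocone on the groups `Hom(X, F j)` extends to `Hom(X, c.pt)` by summing over components, of
which only finitely many are nonzero. -/
lemma preservesColimit_of_finiteSums {J : Type v} {F : J → T} {X : T} {c : Cofan F}
    (hc : IsColimit c) (h : ∀ f : X ⟶ c.pt, f ∈ finiteSums c X) :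
    PreservesColimit (Discrete.functor F) (preadditiveCoyoneda.obj (op X)) := by
  have hfin (f : X ⟶ c.pt) (A : Type v) [AddCommGroup A] (φ : ∀ j, (X ⟶ F j) →+ A) :
      (Function.support fun j => φ j (f ≫ cofanProj hc j)).Finite := by
    obtain ⟨s, hs, -⟩ := exists_finset_of_mem_finiteSums hc (h f)
    refine s.finite_toSet.subset fun j hj => ?_
    by_contra hjs
    exact hj (by simp [hs j hjs])
  have hG : IsColimit ((preadditiveCoyoneda.obj (op X)).mapCocone c) := by
    let φ (s : Cocone (Discrete.functor F ⋙ preadditiveCoyoneda.obj (op X))) (j : J) :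
        (X ⟶ F j) →+ s.pt := (s.ι.app ⟨j⟩).hom
    let ψ (s : Cocone (Discrete.functor F ⋙ preadditiveCoyoneda.obj (op X))) :
        (X ⟶ c.pt) →+ s.pt :=
      { toFun := fun f => ∑ᶠ j, φ s j (f ≫ cofanProj hc j)
        map_zero' := by simp
        map_add' := fun f g => by
          rw [← finsum_add_distrib (hfin f s.pt (φ s)) (hfin g s.pt (φ s))]
          exact finsum_congr fun j => by rw [Preadditive.add_comp, map_add] }
    have hψ (s : Cocone (Discrete.functor F ⋙ preadditiveCoyoneda.obj (op X))) {j : J}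
        (g : X ⟶ F j) : ψ s (g ≫ c.inj j) = φ s j g := by
      change (∑ᶠ i, φ s i ((g ≫ c.inj j) ≫ cofanProj hc i)) = _
      rw [finsum_eq_single _ j]
      · simp
      · intro i hi
        rw [Category.assoc, inj_cofanProj_of_ne hc hi.symm, comp_zero, map_zero]
    exact
      { desc s := AddCommGrpCat.ofHom (ψ s)
        fac s j := by
          ext (g : X ⟶ F j.as)
          exact hψ s g
        uniq s m hm := by
          ext (f : X ⟶ c.pt)
          let m' : (X ⟶ c.pt) →+ s.pt := m.hom
          change m' f = ψ s f
          obtain ⟨t, -, ht⟩ := exists_finset_of_mem_finiteSums hc (h f)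
          rw [ht, map_sum, map_sum]
          refine Finset.sum_congr rfl fun j _ => ?_
          rw [← Category.assoc, hψ]
          exact ConcreteCategory.congr_hom (hm ⟨j⟩) (f ≫ cofanProj hc j : X ⟶ F j) }
  exact preservesColimit_of_preserves_colimit_cocone hc hG

lemma compactObjects_of_finiteSums [HasCoproducts.{v} T] {X : T}
    (h : ∀ (J : Type v) (F : J → T) (c : Cofan F), IsColimit c →
      ∀ f : X ⟶ c.pt, f ∈ finiteSums c X) : compactObjects T X := by
  intro J
  refine ⟨fun {K} => ?_⟩
  have : PreservesColimit (Discrete.functor (K.obj ∘ Discrete.mk))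
      (preadditiveCoyoneda.obj (op X)) :=
    preservesColimit_of_finiteSums (coproductIsCoproduct fun j => K.obj ⟨j⟩)
      (h J _ _ (coproductIsCoproduct _))
  exact preservesColimit_of_iso_diagram _ Discrete.natIsoFunctor.symm

end Compact

/-! ### Compact objects form a thick subcategory -/

section Thick

variable {T : Type u} [Category.{v} T] [Preadditive T] [HasCoproducts.{v} T]

instance : (compactObjects T).IsStableUnderRetracts where
  of_retract r hY := compactObjects_of_finiteSums fun J F c hc f => by
    have := comp_mem_finiteSums r.i (mem_finiteSums_of_compactObjects hY hc (r.r ≫ f))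
    simpa using this

variable [HasZeroObject T] [HasShift T ℤ]
  [∀ n : ℤ, (shiftFunctor T n).Additive] [Pretriangulated T]

lemma compactObjects_zero : compactObjects T 0 :=
  compactObjects_of_finiteSums fun J F c hc f => by
    rw [(isZero_zero T).eq_of_src f 0]; exact zero_mem _

instance : (compactObjects T).IsStableUnderShift ℤ where
  isStableUnderShiftBy n := ⟨fun X hX => compactObjects_of_finiteSums fun J F c hc f => by
    -- Shifting by `-n` makes the source isomorphic to the compact object `X`; decompositions
    -- transport back because the shift is fully faithful.
    let c' : Cofan fun j => (F j)⟦-n⟧ := Cofan.mk (c.pt⟦-n⟧) fun j => (c.inj j)⟦-n⟧'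
    have hc' : IsColimit c' := by
      have := isColimitOfPreserves (shiftFunctor T (-n)) hc
      exact isColimitMapCoconeCofanMkEquiv _ _ _
        (IsColimit.ofIsoColimit this (Cocone.ext (Iso.refl _) (by
          rintro ⟨j⟩; simp; rfl)))
    have hX' : compactObjects T (X⟦n⟧⟦-n⟧) :=
      (compactObjects T).prop_of_iso ((shiftShiftNeg X n).symm) hX
    have lift : ∀ g ∈ finiteSums c' (X⟦n⟧⟦-n⟧), ∃ f ∈ finiteSums c (X⟦n⟧), f⟦-n⟧' = g := by
      intro g hg
      induction hg using AddSubgroup.closure_induction with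
      | mem g hg =>
        obtain ⟨j, g, rfl⟩ := hg
        obtain ⟨g, rfl⟩ := (shiftFunctor T (-n)).map_surjective g
        exact ⟨_, comp_inj_mem_finiteSums c g, Functor.map_comp _ _ _⟩
      | zero => exact ⟨0, zero_mem _, Functor.map_zero _ _ _⟩
      | add _ _ _ _ hf hg =>
        obtain ⟨f, hf, rfl⟩ := hf
        obtain ⟨g, hg, rfl⟩ := hg
        exact ⟨f + g, add_mem hf hg, Functor.map_add _⟩
      | neg _ _ hf =>
        obtain ⟨f, hf, rfl⟩ := hf
        exact ⟨-f, neg_mem hf, Functor.map_neg _⟩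
    obtain ⟨f', hf', h⟩ := lift _ (mem_finiteSums_of_compactObjects hX' hc' (f⟦-n⟧'))
    rwa [(shiftFunctor T (-n)).map_injective h] at hf'⟩

instance : (compactObjects T).IsTriangulated where
  exists_zero := ⟨0, isZero_zero T, compactObjects_zero⟩
  toIsTriangulatedClosed₂ := .mk' fun Δ hΔ h₁ h₃ =>
    compactObjects_of_finiteSums fun J F c hc f => by
      obtain ⟨s, -, hs⟩ := exists_finset_of_mem_finiteSums hc
        (mem_finiteSums_of_compactObjects h₁ hc (Δ.mor₁ ≫ f))
      -- Projection onto the finitely many summands met by `Δ.mor₁ ≫ f`. The error `f - f ≫ e`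
      -- vanishes on `Δ.obj₁`, so it factors through the compact `Δ.obj₃`.
      let e := ∑ j ∈ s, cofanProj hc j ≫ c.inj j
      have hfe : f ≫ e ∈ finiteSums c _ := by
        rw [Preadditive.comp_sum]
        refine sum_mem fun j _ => ?_
        rw [← Category.assoc]
        exact comp_inj_mem_finiteSums c _
      have h0 : Δ.mor₁ ≫ (f - f ≫ e) = 0 := by
        rw [Preadditive.comp_sub, sub_eq_zero]
        conv_lhs => rw [hs]
        simp [e, Preadditive.comp_sum]
      obtain ⟨g, hg⟩ := Triangle.yoneda_exact₂ _ hΔ _ h0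
      have : f = f ≫ e + Δ.mor₂ ≫ g := by rw [← hg]; abel
      rw [this]
      exact add_mem hfe (comp_mem_finiteSums _ (mem_finiteSums_of_compactObjects h₃ hc g))

end Thick

end TTGeometry

namespace TTGeometry

/-! ### Colocal morphisms and their cones -/

section Shift

variable {T : Type u} [Category.{v} T] [Preadditive T] [HasShift T ℤ]

lemma homEquiv_shift_comp {s X Y : T} (n : ℤ) (g : s⟦-n⟧ ⟶ X) (f : X ⟶ Y) :
    (shiftEquiv T n).symm.toAdjunction.homEquiv s X g ≫ f⟦n⟧' =
      (shiftEquiv T n).symm.toAdjunction.homEquiv s Y (g ≫ f) :=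
  ((shiftEquiv T n).symm.toAdjunction.homEquiv_naturality_right g f).symm

/-- If composition with `f` is injective on morphisms from the objects of a shift-stable class,
then so is composition with the shifts of `f`. -/
lemma comp_shift_injective {S : ObjectProperty T} [S.IsStableUnderShift ℤ] {X Y : T} {f : X ⟶ Y}
    (hf : ∀ s, S s → Function.Injective fun g : s ⟶ X => g ≫ f) (n : ℤ) (s : T) (hs : S s) :
    Function.Injective fun g : s ⟶ X⟦n⟧ => g ≫ f⟦n⟧' := by
  intro g₁ g₂ h
  obtain ⟨g₁, rfl⟩ := ((shiftEquiv T n).symm.toAdjunction.homEquiv s X).surjective g₁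
  obtain ⟨g₂, rfl⟩ := ((shiftEquiv T n).symm.toAdjunction.homEquiv s X).surjective g₂
  have h' := (homEquiv_shift_comp n g₁ f).symm.trans (h.trans (homEquiv_shift_comp n g₂ f))
  rw [hf _ (S.le_shift (-n) _ hs) (((shiftEquiv T n).symm.toAdjunction.homEquiv s Y).injective h')]

end Shift

section Colocal

variable {T : Type u} [Category.{v} T] [Preadditive T] [HasZeroObject T] [HasShift T ℤ]
  [∀ n : ℤ, (shiftFunctor T n).Additive] [Pretriangulated T]

section Triangle

variable {X Y Z : T} {f : X ⟶ Y} {g : Y ⟶ Z} {h : Z ⟶ X⟦(1 : ℤ)⟧}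

lemma distTriang_comp_zero₁₂ (hT : Triangle.mk f g h ∈ distTriang T) : f ≫ g = 0 :=
  comp_distTriang_mor_zero₁₂ _ hT

lemma distTriang_comp_zero₃₁ (hT : Triangle.mk f g h ∈ distTriang T) : h ≫ f⟦(1 : ℤ)⟧' = 0 :=
  comp_distTriang_mor_zero₃₁ _ hT

lemma distTriang_exists_lift₃ (hT : Triangle.mk f g h ∈ distTriang T) {A : T} (k : A ⟶ Z)
    (hk : k ≫ h = 0) : ∃ l : A ⟶ Y, k = l ≫ g :=
  Triangle.coyoneda_exact₃ _ hT k hk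

lemma distTriang_exists_desc₂ (hT : Triangle.mk f g h ∈ distTriang T) {A : T} (k : Y ⟶ A)
    (hk : f ≫ k = 0) : ∃ l : Z ⟶ A, k = g ≫ l :=
  Triangle.yoneda_exact₂ _ hT k hk

end Triangle

lemma trW_rightOrthogonal_le_isColocal (S : ObjectProperty T) [S.IsStableUnderShift ℤ] :
    S.rightOrthogonal.trW ≤ S.isColocal := by
  rw [ObjectProperty.le_isColocal_iff, ObjectProperty.isColocal_trW]
  exact fun X hX Y f hY => hY f hX

/-- Injectivity after a shift kills the connecting part of a map into the cone, so the map lifts to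
`Y`; surjectivity lifts it further to `X`, and the composite is zero. -/
lemma isColocal_le_trW_rightOrthogonal (S : ObjectProperty T) [S.IsStableUnderShift ℤ] :
    S.isColocal ≤ S.rightOrthogonal.trW := by
  intro X Y f hf
  obtain ⟨Z, g, h, hT⟩ := distinguished_cocone_triangle f
  refine ⟨Z, g, h, hT, fun s k hs => ?_⟩
  have h₁ : k ≫ h = 0 := by
    refine comp_shift_injective (S := S) (fun s hs => (hf s hs).1) 1 s hs ?_
    dsimp
    rw [Category.assoc, distTriang_comp_zero₃₁ hT, comp_zero, zero_comp]
  obtain ⟨l, rfl⟩ := distTriang_exists_lift₃ hT k h₁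
  obtain ⟨l, rfl⟩ := (hf s hs).2 l
  dsimp
  rw [Category.assoc, distTriang_comp_zero₁₂ hT, comp_zero]

lemma isColocal_eq_trW_rightOrthogonal (S : ObjectProperty T) [S.IsStableUnderShift ℤ] :
    S.isColocal = S.rightOrthogonal.trW :=
  le_antisymm (isColocal_le_trW_rightOrthogonal S) (trW_rightOrthogonal_le_isColocal S)

end Colocal

/-! ### Localizing subcategories and Bousfield colocalization -/

section Localizing

variable {T : Type u} [Category.{v} T] [Preadditive T] [HasZeroObject T] [HasShift T ℤ]
  [∀ n : ℤ, (shiftFunctor T n).Additive] [Pretriangulated T]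

/-- Localizing subcategories: full replete triangulated subcategories closed under small
coproducts. -/
structure IsLocalizing (P : ObjectProperty T) : Prop where
  isTriangulated : P.IsTriangulated
  isClosedUnderIsomorphisms : P.IsClosedUnderIsomorphisms
  isClosedUnderCoproducts : ∀ J : Type v, P.IsClosedUnderColimitsOfShape (Discrete J)

lemma IsLocalizingIdeal.isLocalizing [MonoidalCategory T] {P : ObjectProperty T}
    (hP : IsLocalizingIdeal P) : IsLocalizing P :=
  ⟨hP.isTriangulated, hP.isClosedUnderIsomorphisms, hP.isClosedUnderCoproducts⟩

lemma IsLocalizing.prop_cofan {P : ObjectProperty T} (hP : IsLocalizing P) {J : Type v}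
    {F : J → T} {c : Cofan F} (hc : IsColimit c) (h : ∀ j, P (F j)) : P c.pt := by
  have := hP.isClosedUnderCoproducts J
  exact P.prop_of_isColimit hc fun j => h j.as

lemma IsLocalizing.prop_obj₃ {P : ObjectProperty T} (hP : IsLocalizing P) {Δ : Triangle T}
    (hΔ : Δ ∈ distTriang T) (h₁ : P Δ.obj₁) (h₂ : P Δ.obj₂) : P Δ.obj₃ := by
  have := hP.isTriangulated
  have := hP.isClosedUnderIsomorphisms
  exact P.ext_of_isTriangulatedClosed₃ Δ hΔ h₁ h₂

variable [HasCoproducts.{v} T]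

section Telescope

variable (F : ℕ → T) (t : ∀ n, F n ⟶ F (n + 1))

/-- The coproduct of the terms of a sequence. -/
noncomputable abbrev seqCofan : Cofan fun j : ULift.{v} ℕ => F j.down :=
  Cofan.mk _ (Sigma.ι fun j : ULift.{v} ℕ => F j.down)

/-- The universal property of `seqCofan`. -/
noncomputable def seqCofanIsColimit : IsColimit (seqCofan F) :=
  coproductIsCoproduct _

/-- The endomorphism of the coproduct of the terms of a sequence given by the transition maps. -/
noncomputable def seqShift : (seqCofan F).pt ⟶ (seqCofan F).pt :=
  Cofan.IsColimit.desc (seqCofanIsColimit F) fun j => t j.down ≫ (seqCofan F).inj ⟨j.down + 1⟩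

lemma inj_seqShift (n : ℕ) :
    (seqCofan F).inj ⟨n⟩ ≫ seqShift F t = t n ≫ (seqCofan F).inj ⟨n + 1⟩ :=
  Cofan.IsColimit.fac (seqCofanIsColimit F) _ _

lemma seqShift_cofanProj_zero :
    seqShift F t ≫ cofanProj (seqCofanIsColimit F) ⟨0⟩ = 0 := by
  refine Cofan.IsColimit.hom_ext (seqCofanIsColimit F) _ _ fun ⟨n⟩ => ?_
  rw [reassoc_of% (inj_seqShift F t n), inj_cofanProj_of_ne _ (by simp), comp_zero, comp_zero]

lemma seqShift_cofanProj_succ (n : ℕ) :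
    seqShift F t ≫ cofanProj (seqCofanIsColimit F) ⟨n + 1⟩ =
      cofanProj (seqCofanIsColimit F) ⟨n⟩ ≫ t n := by
  refine Cofan.IsColimit.hom_ext (seqCofanIsColimit F) _ _ fun ⟨m⟩ => ?_
  rw [reassoc_of% (inj_seqShift F t m)]
  by_cases h : m = n
  · subst h
    rw [inj_cofanProj_self, reassoc_of% (inj_cofanProj_self (seqCofanIsColimit F) ⟨m⟩),
      Category.comp_id]
  · rw [inj_cofanProj_of_ne _ (by simpa using h), comp_zero,
      reassoc_of% (inj_cofanProj_of_ne (seqCofanIsColimit F) (i := ⟨m⟩) (j := ⟨n⟩)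
        (by simpa using h)), zero_comp]

/-- A map fixed by the shift has zero component at `0`, hence inductively at every `n`; finiteness
then makes the map itself zero. -/
lemma eq_zero_of_comp_one_sub_seqShift {s : T} {g : s ⟶ (seqCofan F).pt}
    (hg : g ∈ finiteSums (seqCofan F) s) (h : g ≫ (𝟙 _ - seqShift F t) = 0) : g = 0 := by
  rw [Preadditive.comp_sub, Category.comp_id, sub_eq_zero] at h
  refine eq_zero_of_mem_finiteSums (seqCofanIsColimit F) hg fun ⟨n⟩ => ?_
  induction n with
  | zero => rw [h, Category.assoc, seqShift_cofanProj_zero, comp_zero]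
  | succ n ih =>
    rw [h, Category.assoc, seqShift_cofanProj_succ, reassoc_of% ih, zero_comp]

variable {F t}

/-- After `q`, a summand may be replaced by any later one, so finitely many summands can be pushed
to a common stage. -/
lemma exists_factor_of_mem_finiteSums {H : T} {q : (seqCofan F).pt ⟶ H}
    (hq : (𝟙 _ - seqShift F t) ≫ q = 0) {s : T} {g : s ⟶ (seqCofan F).pt}
    (hg : g ∈ finiteSums (seqCofan F) s) :
    ∃ (n : ℕ) (k : s ⟶ F n), g ≫ q = k ≫ (seqCofan F).inj ⟨n⟩ ≫ q := by
  have hq' (n : ℕ) : (seqCofan F).inj ⟨n⟩ ≫ q = t n ≫ (seqCofan F).inj ⟨n + 1⟩ ≫ q := by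
    rw [Preadditive.sub_comp, Category.id_comp, sub_eq_zero] at hq
    conv_lhs => rw [hq]
    rw [reassoc_of% (inj_seqShift F t n)]
  have raise {n m : ℕ} (hnm : n ≤ m) (k : s ⟶ F n) : ∃ k' : s ⟶ F m,
      k ≫ (seqCofan F).inj ⟨n⟩ ≫ q = k' ≫ (seqCofan F).inj ⟨m⟩ ≫ q := by
    induction m, hnm using Nat.le_induction with
    | base => exact ⟨k, rfl⟩
    | succ m _ ih =>
      obtain ⟨k', hk'⟩ := ih
      exact ⟨k' ≫ t m, by rw [hk', hq' m, Category.assoc]⟩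
  induction hg using AddSubgroup.closure_induction with
  | mem g hg =>
    obtain ⟨⟨n⟩, g, rfl⟩ := hg
    exact ⟨n, g, Category.assoc _ _ _⟩
  | zero => exact ⟨0, 0, by simp⟩
  | add f g _ _ hf hg =>
    obtain ⟨n, k, hk⟩ := hf
    obtain ⟨m, l, hl⟩ := hg
    obtain ⟨k', hk'⟩ := raise (le_max_left n m) k
    obtain ⟨l', hl'⟩ := raise (le_max_right n m) l
    exact ⟨max n m, k' + l', by rw [Preadditive.add_comp, hk, hl, hk', hl', Preadditive.add_comp]⟩
  | neg f _ hf =>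
    obtain ⟨n, k, hk⟩ := hf
    exact ⟨n, -k, by rw [Preadditive.neg_comp, hk, Preadditive.neg_comp]⟩

/-- The homotopy colimit of a sequence of approximations of `X`. -/
lemma exists_isColocal_of_sequence {S P : ObjectProperty T} [S.IsStableUnderShift ℤ]
    (hS : S ≤ compactObjects T) (hP : IsLocalizing P) (hF : ∀ n, P (F n)) {X : T}
    (p : ∀ n, F n ⟶ X) (hp : ∀ n, t n ≫ p (n + 1) = p n)
    (hker : ∀ n s (g : s ⟶ F n), S s → g ≫ p n = 0 → g ≫ t n = 0)
    (hsurj : ∀ s (g : s ⟶ X), S s → ∃ g' : s ⟶ F 0, g' ≫ p 0 = g) :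
    ∃ (H : T) (π : H ⟶ X), P H ∧ S.isColocal π := by
  obtain ⟨H, q, h, hT⟩ := distinguished_cocone_triangle (𝟙 _ - seqShift F t)
  have hq : (𝟙 _ - seqShift F t) ≫ q = 0 := comp_distTriang_mor_zero₁₂ _ hT
  have hq' (n : ℕ) : (seqCofan F).inj ⟨n⟩ ≫ q = t n ≫ (seqCofan F).inj ⟨n + 1⟩ ≫ q := by
    rw [← reassoc_of% (inj_seqShift F t n)]
    rw [Preadditive.sub_comp, Category.id_comp, sub_eq_zero] at hq
    rw [← hq]
  let d : (seqCofan F).pt ⟶ X := Cofan.IsColimit.desc (seqCofanIsColimit F) fun j => p j.down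
  have hd (n : ℕ) : (seqCofan F).inj ⟨n⟩ ≫ d = p n :=
    Cofan.IsColimit.fac (seqCofanIsColimit F) _ _
  have hd₀ : (𝟙 _ - seqShift F t) ≫ d = 0 := by
    refine Cofan.IsColimit.hom_ext (seqCofanIsColimit F) _ _ fun ⟨n⟩ => ?_
    rw [Preadditive.sub_comp, Category.id_comp, Preadditive.comp_sub,
      reassoc_of% (inj_seqShift F t n), hd, hd, hp, sub_self, comp_zero]
  obtain ⟨π, hπ⟩ := distTriang_exists_desc₂ hT d hd₀
  have hpt : P (seqCofan F).pt := hP.prop_cofan (seqCofanIsColimit F) fun j => hF j.down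
  refine ⟨H, π, hP.prop_obj₃ hT hpt hpt, fun s hs => ⟨?_, fun g => ?_⟩⟩
  · suffices h₀ : ∀ f : s ⟶ H, f ≫ π = 0 → f = 0 by
      intro f g hfg
      rw [← sub_eq_zero]
      refine h₀ _ ?_
      rw [Preadditive.sub_comp, sub_eq_zero]
      exact hfg
    intro f hf
    -- Since `1 - seqShift` is injective on maps from `S`, `f` lifts to the coproduct. It then comes
    -- from a finite stage, where it dies in `X` and hence at the next stage.
    have hfh : f ≫ h = 0 := by
      refine comp_shift_injective (S := S) (f := 𝟙 _ - seqShift F t) ?_ 1 s hs ?_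
      · intro s hs g₁ g₂ hg
        rw [← sub_eq_zero]
        refine eq_zero_of_comp_one_sub_seqShift F t
          (mem_finiteSums_of_compactObjects (hS _ hs) (seqCofanIsColimit F) _) ?_
        rw [Preadditive.sub_comp, sub_eq_zero]
        exact hg
      · dsimp only
        rw [Category.assoc, distTriang_comp_zero₃₁ hT, comp_zero, zero_comp]
    obtain ⟨g, rfl⟩ := distTriang_exists_lift₃ hT f hfh
    obtain ⟨n, k, hk⟩ := exists_factor_of_mem_finiteSums hq
      (mem_finiteSums_of_compactObjects (hS _ hs) (seqCofanIsColimit F) g)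
    have hk₀ : k ≫ p n = 0 := by
      rw [hk] at hf
      rw [← hd, hπ]
      simpa only [Category.assoc] using hf
    rw [hk, hq', reassoc_of% (hker n s k hs hk₀), zero_comp]
  · obtain ⟨g', rfl⟩ := hsurj s g hs
    refine ⟨g' ≫ (seqCofan F).inj ⟨0⟩ ≫ q, ?_⟩
    dsimp only
    rw [Category.assoc, Category.assoc, ← hπ, hd]

end Telescope

/-- Coproducts of copies of objects from an essentially small class `S` that approximate a given
class of morphisms. -/
lemma exists_approximation {S P : ObjectProperty T} [ObjectProperty.EssentiallySmall.{v} S]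
    (hP : IsLocalizing P) (hSP : S ≤ P) (Y : T) (K : ∀ s : T, (s ⟶ Y) → Prop)
    (hK : ∀ (s s' : T) (e : s' ⟶ s) (g : s ⟶ Y), K s g → K s' (e ≫ g)) :
    ∃ (Z : T) (q : Z ⟶ Y), P Z ∧ (∀ s (g : s ⟶ Y), S s → K s g → ∃ g', g' ≫ q = g) ∧
      ∀ (X : T) (p : Y ⟶ X), (∀ s (g : s ⟶ Y), S s → K s g → g ≫ p = 0) → q ≫ p = 0 := by
  -- Small representatives keep the index type of the coproduct in `Type v`.
  obtain ⟨Q, hQ, hQS, hSQ⟩ := ObjectProperty.EssentiallySmall.exists_small_le.{v} S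
  have : Small.{v} (Subtype Q) := hQ
  let σ : Shrink.{v} (Subtype Q) → T := fun i => ((equivShrink (Subtype Q)).symm i).1
  have hσ (i) : S (σ i) := hQS _ ((equivShrink (Subtype Q)).symm i).2
  let J : Type v := Σ i, {g : σ i ⟶ Y // K _ g}
  let q : (∐ fun j : J => σ j.1) ⟶ Y := Sigma.desc fun j : J => j.2.1
  refine ⟨_, q, hP.prop_cofan (coproductIsCoproduct _) fun j : J => hSP _ (hσ j.1), ?_, ?_⟩
  · intro s g hs hg
    obtain ⟨s', hs', ⟨e⟩⟩ := hSQ s hs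
    obtain ⟨i, rfl⟩ : ∃ i, σ i = s' :=
      ⟨equivShrink _ ⟨s', hs'⟩, by simp [σ]⟩
    let j : J := ⟨i, e.inv ≫ g, hK _ _ _ _ hg⟩
    refine ⟨e.hom ≫ Sigma.ι (fun j : J => σ j.1) j, ?_⟩
    simp [q, j]
  · intro X p hp
    refine Sigma.hom_ext _ _ fun j => ?_
    simp only [q, Sigma.ι_desc_assoc, comp_zero]
    exact hp _ _ (hσ _) j.2.2

/-- Bousfield localization at an essentially small class of compact objects. -/
lemma exists_isColocal {S P : ObjectProperty T} [S.IsStableUnderShift ℤ]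
    [ObjectProperty.EssentiallySmall.{v} S] (hS : S ≤ compactObjects T)
    (hP : IsLocalizing P) (hSP : S ≤ P) (X : T) :
    ∃ (H : T) (π : H ⟶ X), P H ∧ S.isColocal π := by
  -- Cone off all maps from `S` to `A` that die in `X`; the structure map extends over the cone
  -- precisely because they die.
  have step (A : {A : Over X // P A.left}) : ∃ (B : {A : Over X // P A.left}) (t : A.1 ⟶ B.1),
      ∀ s (g : s ⟶ A.1.left), S s → g ≫ A.1.hom = 0 → g ≫ t.left = 0 := by
    obtain ⟨A, hA⟩ := A
    obtain ⟨Z, q, hZ, hq, hq'⟩ := exists_approximation (S := S) hP hSP A.left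
      (fun s g => g ≫ A.hom = 0) (fun s s' e g hg => by rw [Category.assoc, hg, comp_zero])
    obtain ⟨B, t, h, hT⟩ := distinguished_cocone_triangle q
    obtain ⟨p, hp⟩ := distTriang_exists_desc₂ hT A.hom (hq' _ _ fun _ _ _ hg => hg)
    refine ⟨⟨Over.mk p, hP.prop_obj₃ hT hZ hA⟩, Over.homMk t hp.symm, fun s g hs hg => ?_⟩
    obtain ⟨g', rfl⟩ := hq s g hs hg
    change (g' ≫ q) ≫ t = 0
    rw [Category.assoc, distTriang_comp_zero₁₂ hT, comp_zero]
  choose next t ht using step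
  obtain ⟨Z, q, hZ, hq, -⟩ := exists_approximation (S := S) hP hSP X
    (fun s g => True) (fun _ _ _ _ _ => trivial)
  let A (n : ℕ) : {A : Over X // P A.left} := next^[n] ⟨Over.mk q, hZ⟩
  have hA (n : ℕ) : A (n + 1) = next (A n) := Function.iterate_succ_apply' _ _ _
  -- `A (n + 1)` and `next (A n)` agree only propositionally.
  let τ (n : ℕ) : (A n).1 ⟶ (A (n + 1)).1 := t (A n) ≫ eqToHom (by rw [hA])
  refine exists_isColocal_of_sequence (F := fun n => (A n).1.left) (t := fun n => (τ n).left)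
    hS hP (fun n => (A n).2) (fun n => (A n).1.hom) (fun n => Over.w (τ n)) ?_ ?_
  · intro n s g hs hg
    have := ht (A n) s g hs hg
    simp only [τ, Over.comp_left]
    rw [reassoc_of% this, zero_comp]
  · intro s g hs
    exact hq s g hs trivial

end Localizing

end TTGeometry

namespace TTGeometry

/-! ### Adjoints and orthogonals -/

section Adjoints

variable {T : Type u} [Category.{v} T]

lemma isLeftAdjoint_ι_of_isColocal {A : ObjectProperty T}
    (h : ∀ X, ∃ (H : T) (π : H ⟶ X), A H ∧ A.isColocal π) : A.ι.IsLeftAdjoint := by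
  choose H π hH hπ using h
  exact (Adjunction.adjunctionOfEquivRight (F := A.ι) (G_obj := fun X => ⟨H X, hH X⟩)
    (fun Y X => ((A.fullyFaithfulι.homEquiv (Y := ⟨H X, hH X⟩)).trans
      (Equiv.ofBijective _ (hπ X _ Y.2))).symm)
    (fun Y' Y X f g => by
      rw [Equiv.symm_apply_eq]
      obtain ⟨g, rfl⟩ := ((A.fullyFaithfulι.homEquiv (X := Y) (Y := ⟨H X, hH X⟩)).trans
        (Equiv.ofBijective _ (hπ X _ Y.2))).surjective g
      rw [Equiv.symm_apply_apply]
      simp [Functor.FullyFaithful.homEquiv])).isLeftAdjoint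

lemma isRightAdjoint_ι_of_isLocal {A : ObjectProperty T}
    (h : ∀ X, ∃ (L : T) (η : X ⟶ L), A L ∧ A.isLocal η) : A.ι.IsRightAdjoint := by
  choose L η hL hη using h
  exact (Adjunction.adjunctionOfEquivLeft (G := A.ι) (F_obj := fun X => ⟨L X, hL X⟩)
    (fun X Y => (A.fullyFaithfulι.homEquiv (X := ⟨L X, hL X⟩)).trans
      (Equiv.ofBijective _ (hη X _ Y.2)))
    (fun X Y' Y f g => by simp [Functor.FullyFaithful.homEquiv])).isRightAdjoint

end Adjoints

section Orthogonal

variable {T : Type u} [Category.{v} T] [Preadditive T] [HasZeroObject T] [HasShift T ℤ]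
  [∀ n : ℤ, (shiftFunctor T n).Additive] [Pretriangulated T]

lemma trW_le_isLocal_rightOrthogonal (S : ObjectProperty T) [S.IsStableUnderShift ℤ]
    {X Y Z : T} {f : X ⟶ Y} {g : Y ⟶ Z} {h : Z ⟶ X⟦(1 : ℤ)⟧}
    (hT : Triangle.mk f g h ∈ distTriang T) (hX : S X) : S.rightOrthogonal.isLocal g := by
  intro L hL
  refine ⟨fun a b hab => ?_, fun a => ?_⟩
  · rw [← sub_eq_zero]
    have : g ≫ (a - b) = 0 := by rw [Preadditive.comp_sub, sub_eq_zero]; exact hab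
    obtain ⟨l, hl⟩ := Triangle.yoneda_exact₃ _ hT (a - b) this
    rw [hl, hL l (S.le_shift 1 _ hX)]
    exact comp_zero
  · obtain ⟨l, hl⟩ := distTriang_exists_desc₂ hT a (hL _ hX)
    exact ⟨l, hl.symm⟩

lemma isLocalizing_leftOrthogonal (Q : ObjectProperty T) [Q.IsStableUnderShift ℤ] :
    IsLocalizing Q.leftOrthogonal where
  isTriangulated := inferInstance
  isClosedUnderIsomorphisms := inferInstance
  isClosedUnderCoproducts J := ⟨by
    rintro X ⟨c⟩ Y f hY
    exact c.isColimit.hom_ext fun j => by rw [c.prop_diag_obj j (c.ι.app j ≫ f) hY, comp_zero]⟩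

lemma IsLocalizing.iInf {ι : Sort*} {P : ι → ObjectProperty T} (hP : ∀ i, IsLocalizing (P i)) :
    IsLocalizing (fun X => ∀ i, P i X) := by
  have iso : ObjectProperty.IsClosedUnderIsomorphisms (fun X => ∀ i, P i X) :=
    ⟨fun e hX i => have := (hP i).isClosedUnderIsomorphisms; (P i).prop_of_iso e (hX i)⟩
  refine ⟨?_, iso, fun J => ⟨?_⟩⟩
  · have zero : ObjectProperty.ContainsZero (fun X => ∀ i, P i X) :=
      ⟨0, isZero_zero T, fun i =>
        have := (hP i).isTriangulated
        have := (hP i).isClosedUnderIsomorphisms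
        (P i).prop_zero⟩
    have shift : ObjectProperty.IsStableUnderShift (fun X => ∀ i, P i X) ℤ :=
      ⟨fun n => ⟨fun X hX i =>
        have := (hP i).isTriangulated
        (P i).le_shift n _ (hX i)⟩⟩
    have ext : ObjectProperty.IsTriangulatedClosed₂ (fun X => ∀ i, P i X) :=
      .mk' fun Δ hΔ h₁ h₃ i =>
        have := (hP i).isTriangulated
        have := (hP i).isClosedUnderIsomorphisms
        (P i).ext_of_isTriangulatedClosed₂ Δ hΔ (h₁ i) (h₃ i)
    constructor
  · rintro X ⟨c⟩ i
    have := (hP i).isClosedUnderCoproducts J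
    exact (P i).prop_of_isColimit c.isColimit fun j => c.prop_diag_obj j i

end Orthogonal

/-! ### Rigidity and localizing ideals -/

section Tensor

variable {T : Type u} [Category.{v} T] [Preadditive T] [HasZeroObject T] [HasShift T ℤ]
  [∀ n : ℤ, (shiftFunctor T n).Additive] [Pretriangulated T]
  [MonoidalCategory T] [SymmetricCategory T]

lemma isZero_tensor [TensorTriangulated T] (Z : T) {X : T} (hX : IsZero X) : IsZero (Z ⊗ X) := by
  obtain ⟨_, _⟩ := TensorTriangulated.exact_tensorLeft Z
  exact (tensorLeft Z).map_isZero hX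

lemma isTriangulated_inverseImage_tensorLeft [TensorTriangulated T] (Z : T) (P : ObjectProperty T)
    [P.IsTriangulated] [P.IsClosedUnderIsomorphisms] :
    (P.inverseImage (tensorLeft Z)).IsTriangulated := by
  obtain ⟨_, _⟩ := TensorTriangulated.exact_tensorLeft Z
  infer_instance

/-- A dualizable object is a retract of the tensor product with itself and its dual. -/
def retractTensor (b b' : T) [ExactPairing b b'] : Retract b ((b ⊗ b') ⊗ b) where
  i := (λ_ b).inv ≫ η_ b b' ▷ b
  r := (α_ _ _ _).hom ≫ b ◁ ε_ b b' ≫ (ρ_ b).hom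
  retract := by simp

/-- Writing `b` as a retract of `b ⊗ b' ⊗ b` and sliding `f` along, `f` factors through `X ⊗ b' ⊗
b`, which is zero with `b ⊗ X`. -/
lemma eq_zero_of_isZero_tensor [TensorTriangulated T] {b b' X : T} [ExactPairing b b']
    (h : IsZero (b ⊗ X)) (f : b ⟶ X) : f = 0 := by
  have h₀ : IsZero (X ⊗ b' ⊗ b) :=
    (isZero_tensor b' h).of_iso (β_ X (b' ⊗ b) ≪≫ α_ b' b X)
  calc
    f = (retractTensor b b').i ≫ (retractTensor b b').r ≫ f := by simp
    _ = (retractTensor b b').i ≫ (α_ _ _ _).hom ≫ f ▷ (b' ⊗ b) ≫ X ◁ ε_ b b' ≫ (ρ_ X).hom := by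
      rw [← whisker_exchange_assoc]
      simp [retractTensor]
    _ = 0 := by rw [h₀.eq_of_tgt (f ▷ (b' ⊗ b)) 0]; simp

variable [HasCoproducts.{v} T] [RigidlyCompactlyGenerated T]

lemma exists_exactPairing {a : T} (ha : compactObjects T a) :
    ∃ b, compactObjects T b ∧ Nonempty (ExactPairing a b) ∧ Nonempty (ExactPairing b a) := by
  obtain ⟨b, ⟨e⟩⟩ := (RigidlyCompactlyGenerated.compact_iff_rigid a).1 ha
  have e' : ExactPairing b a := BraidedCategory.exactPairing_swap a b
  exact ⟨b, (RigidlyCompactlyGenerated.compact_iff_rigid b).2 ⟨a, ⟨e'⟩⟩, ⟨e⟩, ⟨e'⟩⟩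

lemma compactObjects_unit : compactObjects T (𝟙_ T) :=
  (RigidlyCompactlyGenerated.compact_iff_rigid _).2 ⟨𝟙_ T, ⟨inferInstance⟩⟩

lemma compactObjects_tensor {a b : T} (ha : compactObjects T a) (hb : compactObjects T b) :
    compactObjects T (a ⊗ b) := by
  obtain ⟨a', -, ⟨_⟩, -⟩ := exists_exactPairing ha
  obtain ⟨b', -, ⟨_⟩, -⟩ := exists_exactPairing hb
  exact (RigidlyCompactlyGenerated.compact_iff_rigid _).2 ⟨b' ⊗ a', ⟨inferInstance⟩⟩

instance : ObjectProperty.EssentiallySmall.{v} (compactObjects T) :=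
  RigidlyCompactlyGenerated.essentiallySmall_compactObjects

lemma isLocalizing_inverseImage_tensorLeft (Z : T) {P : ObjectProperty T} (hP : IsLocalizing P) :
    IsLocalizing (P.inverseImage (tensorLeft Z)) := by
  have := hP.isTriangulated
  have := hP.isClosedUnderIsomorphisms
  refine ⟨isTriangulated_inverseImage_tensorLeft Z P, inferInstance, fun J => ⟨?_⟩⟩
  rintro X ⟨c⟩
  have := hP.isClosedUnderCoproducts J
  have := RigidlyCompactlyGenerated.tensorLeft_preservesCoproducts Z J
  exact P.prop_of_isColimit (isColimitOfPreserves (tensorLeft Z) c.isColimit)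
    fun j => c.prop_diag_obj j

/-- The compact objects generate `T` as a localizing subcategory. -/
lemma IsLocalizing.prop_of_compactObjects_le {P : ObjectProperty T} (hP : IsLocalizing P)
    (h : compactObjects T ≤ P) (X : T) : P X := by
  have := hP.isClosedUnderIsomorphisms
  -- The cone of the colocalization receives no nonzero map from a compact object, so it vanishes.
  obtain ⟨H, π, hH, hπ⟩ := exists_isColocal le_rfl hP h X
  obtain ⟨Z, g, k, hT, hZ⟩ := isColocal_le_trW_rightOrthogonal _ _ hπ
  have hZ₀ : IsZero Z := RigidlyCompactlyGenerated.isZero_of_forall_compact Z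
    fun a ha f => hZ f ha
  have : IsIso π := (Triangle.isZero₃_iff_isIso₁ _ hT).1 hZ₀
  exact P.prop_of_iso (asIso π) hH

/-- The double orthogonal `Q` of `S` is localizing but not visibly an ideal. The objects `X` with `Z
⊗ X` in `Q` for all `Z` do form one; it contains `S` because, for fixed `s`, the admissible `Z` form
a localizing subcategory containing the compact objects. Taking `Z` to be the unit concludes. -/
lemma rightOrthogonal_localizingIdeal {S : ObjectProperty T} [S.IsStableUnderShift ℤ]
    [S.IsClosedUnderIsomorphisms]
    (hS : ∀ c s, compactObjects T c → S s → S (c ⊗ s)) :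
    (localizingIdeal S).rightOrthogonal = S.rightOrthogonal := by
  refine le_antisymm (fun X hX s f hs => hX f (le_localizingIdeal S _ hs)) ?_
  let Q := S.rightOrthogonal.leftOrthogonal
  have hQ : IsLocalizing Q := isLocalizing_leftOrthogonal _
  have hSQ : S ≤ Q := fun s hs Y f hY => hY f hs
  have := hQ.isClosedUnderIsomorphisms
  have hP : IsLocalizing (fun X => ∀ Z, Q.inverseImage (tensorLeft Z) X) :=
    IsLocalizing.iInf fun Z => isLocalizing_inverseImage_tensorLeft Z hQ
  intro L hL X f hX
  have hX' : Q (𝟙_ T ⊗ X) := by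
    refine hX (fun X => ∀ Z, Q.inverseImage (tensorLeft Z) X)
      ⟨hP.isTriangulated, hP.isClosedUnderIsomorphisms, hP.isClosedUnderCoproducts, ?_⟩ ?_ _
    · exact fun X Y hY Z => Q.prop_of_iso (α_ Z X Y) (hY (Z ⊗ X))
    · intro s hs Z
      have : Q.inverseImage (tensorLeft s) Z :=
        (isLocalizing_inverseImage_tensorLeft s hQ).prop_of_compactObjects_le
          (fun c hc => Q.prop_of_iso (β_ c s) (hSQ _ (hS c s hc hs))) Z
      exact Q.prop_of_iso (β_ s Z) this
  exact (Q.prop_of_iso (λ_ X) hX') f hL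

end Tensor

/-! ### Torsion categories and their adjoints -/

section Supported

variable {T : Type u} [Category.{v} T] [Preadditive T] [HasZeroObject T] [HasShift T ℤ]
  [∀ n : ℤ, (shiftFunctor T n).Additive] [Pretriangulated T]
  [MonoidalCategory T] [SymmetricCategory T]

/-- The compact objects supported on a subset of the prism. -/
def supportedIn (W : Set (Prism T)) : ObjectProperty T :=
  fun a => compactObjects T a ∧ supp a ⊆ W

lemma supportedIn_le_compactObjects (W : Set (Prism T)) : supportedIn W ≤ compactObjects T :=
  fun _ h => h.1

lemma supportedIn_le_torsion (W : Set (Prism T)) : supportedIn W ≤ torsion W :=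
  le_localizingIdeal _

lemma supp_subset_of_retract {a b : T} (r : Retract a b) : supp a ⊆ supp b := fun P ha hb =>
  have := P.isStableUnderRetracts
  ha (P.carrier.prop_of_retract r hb)

lemma supp_shift (a : T) (n : ℤ) : supp (a⟦n⟧) = supp a := by
  ext P
  have := P.isTriangulated
  have := P.isStableUnderRetracts
  exact not_congr (P.carrier.prop_shift_iff_of_isStableUnderShift a n)

lemma supp_tensor_subset_right {a : T} (ha : compactObjects T a) (b : T) :
    supp (a ⊗ b) ⊆ supp b :=
  fun P h hb => h (P.tensor_mem a b ha hb)

lemma supp_tensor_subset_left {b : T} (a : T) (hb : compactObjects T b) :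
    supp (a ⊗ b) ⊆ supp a :=
  (supp_subset_of_retract (β_ a b).retract).trans (supp_tensor_subset_right hb a)

lemma supp_tensor {a b : T} (ha : compactObjects T a) (hb : compactObjects T b) :
    supp (a ⊗ b) = supp a ∩ supp b :=
  Set.Subset.antisymm
    (Set.subset_inter (supp_tensor_subset_left a hb) (supp_tensor_subset_right ha b))
    fun P h hab => (P.mem_or_mem a b ha hb hab).elim h.1 h.2

lemma supp_unit [HasCoproducts.{v} T] [RigidlyCompactlyGenerated T] :
    supp (𝟙_ T) = Set.univ := by
  refine Set.eq_univ_of_forall fun P h => ?_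
  obtain ⟨a, ha, ha'⟩ := P.exists_notMem
  have := P.isStableUnderRetracts
  exact ha' (P.carrier.prop_of_iso (ρ_ a) (P.tensor_mem a _ ha h))

lemma torsion_mono {W W' : Set (Prism T)} (h : W ⊆ W') : torsion W ≤ torsion W' :=
  fun _ hX P hP hS => hX P hP fun a ha => hS a ⟨ha.1, ha.2.trans h⟩

lemma isLocalizingIdeal_torsion (W : Set (Prism T)) : IsLocalizingIdeal (torsion W) :=
  isLocalizingIdeal_localizingIdeal _

lemma isLocalizing_torsion (W : Set (Prism T)) : IsLocalizing (torsion W) :=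
  (isLocalizingIdeal_torsion W).isLocalizing

instance (W : Set (Prism T)) : (torsion W).IsClosedUnderIsomorphisms :=
  (isLocalizing_torsion W).isClosedUnderIsomorphisms

variable [HasCoproducts.{v} T]

instance (W : Set (Prism T)) : (supportedIn W).IsStableUnderRetracts where
  of_retract r hb := ⟨(compactObjects T).prop_of_retract r hb.1,
    (supp_subset_of_retract r).trans hb.2⟩

instance (W : Set (Prism T)) : (supportedIn W).IsStableUnderShift ℤ where
  isStableUnderShiftBy n := ⟨fun a ha => ⟨(compactObjects T).le_shift n _ ha.1,
    (supp_shift a n).subset.trans ha.2⟩⟩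

variable [RigidlyCompactlyGenerated T]

instance (W : Set (Prism T)) : ObjectProperty.EssentiallySmall.{v} (supportedIn W) :=
  .of_le (supportedIn_le_compactObjects W)

lemma supportedIn_tensor {W : Set (Prism T)} {c s : T} (hc : compactObjects T c)
    (hs : supportedIn W s) : supportedIn W (c ⊗ s) :=
  ⟨compactObjects_tensor hc hs.1, (supp_tensor_subset_right hc s).trans hs.2⟩

lemma localAway_eq (W : Set (Prism T)) : localAway W = (supportedIn W).rightOrthogonal :=
  rightOrthogonal_localizingIdeal (S := supportedIn W) fun _ _ => supportedIn_tensor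

/-- Colocality depends only on the right-orthogonal, which is the same for the ideal and its compact
generators. -/
lemma isColocal_torsion (W : Set (Prism T)) :
    (torsion W).isColocal = (supportedIn W).isColocal := by
  rw [isColocal_eq_trW_rightOrthogonal, isColocal_eq_trW_rightOrthogonal, ← localAway_eq]
  rfl

lemma exists_isColocal_torsion (W : Set (Prism T)) (X : T) :
    ∃ (H : T) (π : H ⟶ X), torsion W H ∧ (torsion W).isColocal π := by
  rw [isColocal_torsion]
  exact exists_isColocal (supportedIn_le_compactObjects W) (isLocalizing_torsion W)
    (supportedIn_le_torsion W) X

lemma isLeftAdjoint_torsion_ι (W : Set (Prism T)) : (torsion W).ι.IsLeftAdjoint :=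
  isLeftAdjoint_ι_of_isColocal (exists_isColocal_torsion W)

lemma exists_localization_triangle (V : Set (Prism T)) (X : T) :
    ∃ (H L : T) (π : H ⟶ X) (η : X ⟶ L) (h : L ⟶ H⟦(1 : ℤ)⟧),
      Triangle.mk π η h ∈ distTriang T ∧ torsion V H ∧ localAway V L := by
  obtain ⟨H, π, hH, hπ⟩ := exists_isColocal_torsion V X
  obtain ⟨L, η, h, hT, hL⟩ := isColocal_le_trW_rightOrthogonal _ _ hπ
  exact ⟨H, L, π, η, h, hT, hH, hL⟩

lemma isRightAdjoint_localAway_ι (V : Set (Prism T)) : (localAway V).ι.IsRightAdjoint :=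
  isRightAdjoint_ι_of_isLocal fun X => by
    obtain ⟨H, L, π, η, h, hT, hH, hL⟩ := exists_localization_triangle V X
    exact ⟨L, η, hL, trW_le_isLocal_rightOrthogonal _ hT hH⟩

end Supported

end TTGeometry

/-! ### Thick ideals and prime avoidance -/

namespace TTGeometry

variable {T : Type u} [Category.{v} T] [Preadditive T] [HasZeroObject T] [HasShift T ℤ]
  [∀ n : ℤ, (shiftFunctor T n).Additive] [Pretriangulated T]
  [MonoidalCategory T] [SymmetricCategory T]

/-- Thick tensor-ideals of the category of compact objects. -/
structure IsThickIdeal (J : ObjectProperty T) : Prop where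
  le_compactObjects : J ≤ compactObjects T
  isTriangulated : J.IsTriangulated
  isStableUnderRetracts : J.IsStableUnderRetracts
  tensor_mem : ∀ a b : T, compactObjects T a → J b → J (a ⊗ b)

variable [HasCoproducts.{v} T] [RigidlyCompactlyGenerated T]

section PrimeIdeals

/-- By rigidity `a` is a retract of `b ⊗ (a ⊗ a)` with `b` its dual, so thick ideals are radical. -/
lemma IsThickIdeal.of_tensor_self {J : ObjectProperty T} (hJ : IsThickIdeal J) {a : T}
    (ha : compactObjects T a) (h : J (a ⊗ a)) : J a := by
  have := hJ.isStableUnderRetracts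
  obtain ⟨b, hb, ⟨_⟩, -⟩ := exists_exactPairing ha
  refine J.prop_of_retract (retractTensor a b) (J.prop_of_iso ?_ (hJ.tensor_mem b _ hb h))
  exact (α_ _ _ _).symm ≪≫ whiskerRightIso (β_ b a) a

lemma IsThickIdeal.colon {J : ObjectProperty T} (hJ : IsThickIdeal J) (c : T) :
    IsThickIdeal (compactObjects T ⊓ J.inverseImage (tensorLeft c)) where
  le_compactObjects := inf_le_left
  isTriangulated := by
    have := hJ.isTriangulated
    have := hJ.isStableUnderRetracts
    have := isTriangulated_inverseImage_tensorLeft c J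
    infer_instance
  isStableUnderRetracts := ⟨fun r h =>
    have := hJ.isStableUnderRetracts
    ⟨(compactObjects T).prop_of_retract r h.1, J.prop_of_retract (r.map (tensorLeft c)) h.2⟩⟩
  tensor_mem a b ha hb := by
    have := hJ.isStableUnderRetracts
    refine ⟨compactObjects_tensor ha hb.1, J.prop_of_iso ?_ (hJ.tensor_mem a _ ha hb.2)⟩
    exact (α_ a c b).symm ≪≫ whiskerRightIso (β_ a c) b ≪≫ α_ c a b

lemma IsThickIdeal.le_colon {J : ObjectProperty T} (hJ : IsThickIdeal J) {c : T}
    (hc : compactObjects T c) : J ≤ compactObjects T ⊓ J.inverseImage (tensorLeft c) :=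
  fun b hb => ⟨hJ.le_compactObjects b hb, hJ.tensor_mem c b hc hb⟩

lemma isThickIdeal_of_isChain {C : Set (ObjectProperty T)} (hC : ∀ J ∈ C, IsThickIdeal J)
    (hC' : IsChain (· ≤ ·) C) (hne : C.Nonempty) : IsThickIdeal (fun X => ∃ J ∈ C, J X) := by
  have retr : ObjectProperty.IsStableUnderRetracts (fun X : T => ∃ J ∈ C, J X) :=
    ⟨fun r ⟨J, hJ, h⟩ => ⟨J, hJ, have := (hC J hJ).isStableUnderRetracts; J.prop_of_retract r h⟩⟩
  refine ⟨fun X ⟨J, hJ, h⟩ => (hC J hJ).le_compactObjects X h, ?_, retr,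
    fun a b ha ⟨J, hJ, h⟩ => ⟨J, hJ, (hC J hJ).tensor_mem a b ha h⟩⟩
  have zero : ObjectProperty.ContainsZero (fun X : T => ∃ J ∈ C, J X) := by
    obtain ⟨J, hJ⟩ := hne
    have := (hC J hJ).isTriangulated
    have := (hC J hJ).isStableUnderRetracts
    exact ⟨0, isZero_zero T, J, hJ, J.prop_zero⟩
  have shift : ObjectProperty.IsStableUnderShift (fun X : T => ∃ J ∈ C, J X) ℤ :=
    ⟨fun n => ⟨fun X ⟨J, hJ, h⟩ => ⟨J, hJ, have := (hC J hJ).isTriangulated; J.le_shift n _ h⟩⟩⟩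
  have ext : ObjectProperty.IsTriangulatedClosed₂ (fun X : T => ∃ J ∈ C, J X) := by
    refine .mk' fun Δ hΔ ⟨J₁, hJ₁, h₁⟩ ⟨J₃, hJ₃, h₃⟩ => ?_
    obtain ⟨J, hJ, h₁, h₃⟩ : ∃ J ∈ C, J Δ.obj₁ ∧ J Δ.obj₃ := by
      rcases hC'.total hJ₁ hJ₃ with h | h
      · exact ⟨J₃, hJ₃, h _ h₁, h₃⟩
      · exact ⟨J₁, hJ₁, h₁, h _ h₃⟩
    have := (hC J hJ).isTriangulated
    have := (hC J hJ).isStableUnderRetracts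
    exact ⟨J, hJ, J.ext_of_isTriangulatedClosed₂ Δ hΔ h₁ h₃⟩
  constructor

/-- A compact object outside of a thick tensor-ideal is avoided by a prime containing the ideal. -/
lemma IsThickIdeal.exists_prime {J : ObjectProperty T} (hJ : IsThickIdeal J) {a : T}
    (ha : compactObjects T a) (haJ : ¬ J a) :
    ∃ P : BalmerSpectrum T, J ≤ P.carrier ∧ P ∈ supp a := by
  obtain ⟨M, hJM, hM⟩ := zorn_le_nonempty₀ {K : ObjectProperty T | IsThickIdeal K ∧ ¬ K a}
    (fun C hC hC' K hK => ⟨fun X => ∃ J ∈ C, J X,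
      ⟨isThickIdeal_of_isChain (fun K hK => (hC hK).1) hC' ⟨K, hK⟩,
        fun ⟨K, hK, h⟩ => (hC hK).2 h⟩, fun K hK X hX => ⟨K, hK, hX⟩⟩) J ⟨hJ, haJ⟩
  obtain ⟨hMi, hMa⟩ := hM.prop
  -- If `x ∉ M`, the colon ideal of `c` is strictly larger than `M`, so by maximality it contains
  -- `a`. Using this twice puts `a ⊗ a` in `M`.
  have key (c x : T) (hc : compactObjects T c) (hx : compactObjects T x) (h : M (c ⊗ x))
      (hxM : ¬ M x) : M (c ⊗ a) := by
    by_contra hca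
    refine hxM (hM.2 ⟨hMi.colon c, fun h => hca h.2⟩ (hMi.le_colon hc) x ⟨hx, h⟩)
  have := hMi.isStableUnderRetracts
  refine ⟨{ carrier := M
            le_compactObjects := hMi.le_compactObjects
            isTriangulated := hMi.isTriangulated
            isStableUnderRetracts := hMi.isStableUnderRetracts
            tensor_mem := hMi.tensor_mem
            exists_notMem := ⟨a, ha, hMa⟩
            mem_or_mem := fun b c hb hc h => ?_ }, hJM, hMa⟩
  by_contra! hbc
  have h₁ : M (a ⊗ b) := M.prop_of_iso (β_ b a) (key b c hb hc h hbc.2)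
  exact hMa (hMi.of_tensor_self ha (key a b ha hb h₁ hbc.1))

/-- The compact objects without morphisms to a class of objects that is stable under tensoring
with compact objects form a thick tensor-ideal. -/
lemma isThickIdeal_leftOrthogonal (Q : ObjectProperty T) [Q.IsStableUnderShift ℤ]
    (hQ : ∀ c L, compactObjects T c → Q L → Q (c ⊗ L)) :
    IsThickIdeal (compactObjects T ⊓ Q.leftOrthogonal) where
  le_compactObjects := inf_le_left
  isTriangulated := inferInstance
  isStableUnderRetracts := ⟨fun {X Y} r h => ⟨(compactObjects T).prop_of_retract r h.1,
    fun L f hL => by rw [← cancel_epi r.r, h.2 (r.r ≫ f) hL, comp_zero]⟩⟩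
  tensor_mem c b hc hb := ⟨compactObjects_tensor hc hb.1, fun L f hL => by
    obtain ⟨c', hc', -, ⟨_⟩⟩ := exists_exactPairing hc
    apply (tensorLeftHomEquiv b c' c L).injective
    rw [hb.2 (tensorLeftHomEquiv b c' c L f) (hQ c' L hc' hL), hb.2 (tensorLeftHomEquiv b c' c L 0) (hQ c' L hc' hL)]⟩

/-- Prime avoidance for the ideal of zero objects, obtained as the compact objects left-orthogonal
to everything. -/
lemma isZero_of_supp_eq_empty {a : T} (ha : compactObjects T a) (h : supp a = ∅) : IsZero a := by
  have hJ := isThickIdeal_leftOrthogonal (⊤ : ObjectProperty T) (fun _ _ _ _ => trivial)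
  by_contra h₀
  obtain ⟨P, -, hP⟩ := hJ.exists_prime ha fun h' =>
    h₀ ((IsZero.iff_id_eq_zero a).2 (h'.2 (𝟙 a) trivial))
  rw [h] at hP
  exact hP

end PrimeIdeals

/-! ### Compactness of the prism and supports -/

section Topology

open Topology Filter

/-- The limit of an ultrafilter of prime ideals. -/
def ultrafilterLimit (𝓕 : Ultrafilter (BalmerSpectrum T)) : BalmerSpectrum T where
  carrier a := ∀ᶠ P : BalmerSpectrum T in 𝓕, P.carrier a
  le_compactObjects a h := by
    obtain ⟨P, hP⟩ := h.exists
    exact P.le_compactObjects a hP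
  isTriangulated := by
    have retr : ObjectProperty.IsStableUnderRetracts
        (fun a : T => ∀ᶠ P : BalmerSpectrum T in 𝓕, P.carrier a) :=
      ⟨fun r h => h.mono fun P h => P.isStableUnderRetracts.of_retract r h⟩
    have zero : ObjectProperty.ContainsZero
        (fun a : T => ∀ᶠ P : BalmerSpectrum T in 𝓕, P.carrier a) :=
      ⟨0, isZero_zero T, .of_forall fun P =>
        have := P.isTriangulated
        have := P.isStableUnderRetracts
        P.carrier.prop_zero⟩
    have shift : ObjectProperty.IsStableUnderShift
        (fun a : T => ∀ᶠ P : BalmerSpectrum T in 𝓕, P.carrier a) ℤ :=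
      ⟨fun n => ⟨fun X h => h.mono fun P h =>
        have := P.isTriangulated
        P.carrier.le_shift n _ h⟩⟩
    have ext : ObjectProperty.IsTriangulatedClosed₂
        (fun a : T => ∀ᶠ P : BalmerSpectrum T in 𝓕, P.carrier a) :=
      .mk' fun Δ hΔ h₁ h₃ => (h₁.and h₃).mono fun P h =>
        have := P.isTriangulated
        have := P.isStableUnderRetracts
        P.carrier.ext_of_isTriangulatedClosed₂ Δ hΔ h.1 h.2
    constructor
  isStableUnderRetracts := ⟨fun r h => h.mono fun P h => P.isStableUnderRetracts.of_retract r h⟩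
  tensor_mem a b ha h := h.mono fun P h => P.tensor_mem a b ha h
  exists_notMem := ⟨𝟙_ T, compactObjects_unit, fun h => by
    obtain ⟨P, hP⟩ := h.exists
    exact (supp_unit (T := T)).ge (Set.mem_univ P) hP⟩
  mem_or_mem a b ha hb h :=
    Ultrafilter.eventually_or.1 (h.mono fun P h => P.mem_or_mem a b ha hb h)

lemma le_nhds_ultrafilterLimit (𝓕 : Ultrafilter (BalmerSpectrum T)) :
    (𝓕 : Filter (BalmerSpectrum T)) ≤ 𝓝 (ultrafilterLimit 𝓕) := by
  rw [TopologicalSpace.nhds_generateFrom]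
  refine le_iInf₂ fun s hs => ?_
  obtain ⟨hP, a, ha, rfl⟩ := hs
  rw [le_principal_iff]
  have : ∀ᶠ P : BalmerSpectrum T in 𝓕, P.carrier a := not_not.1 hP
  exact this.mono fun P h => not_not.2 h

/-- The constructed limit is the most generic one, so an open set containing any limit contains it.
This upgrades Zariski convergence to constructible convergence. -/
lemma specializes_ultrafilterLimit {𝓕 : Ultrafilter (BalmerSpectrum T)} {Q : BalmerSpectrum T}
    (h : (𝓕 : Filter (BalmerSpectrum T)) ≤ 𝓝 Q) : ultrafilterLimit 𝓕 ⤳ Q := by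
  rw [specializes_iff]
  intro a ha
  have : (supp a)ᶜ ∈ 𝓝 Q := IsOpen.mem_nhds
    (TopologicalSpace.isOpen_generateFrom_of_mem ⟨a, Q.le_compactObjects a ha, rfl⟩)
    (not_not.2 ha)
  have h' : ∀ᶠ P : BalmerSpectrum T in 𝓕, P.carrier a := by
    filter_upwards [h this] with P hP using not_not.1 hP
  exact h'

lemma isOpen_compl_supp {a : T} (ha : compactObjects T a) :
    IsOpen (supp a : Set (BalmerSpectrum T))ᶜ :=
  TopologicalSpace.isOpen_generateFrom_of_mem ⟨a, ha, rfl⟩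

lemma isCompact_compl_supp (a : T) : IsCompact (supp a : Set (BalmerSpectrum T))ᶜ := by
  rw [isCompact_iff_ultrafilter_le_nhds]
  intro 𝓕 h𝓕
  refine ⟨_, ?_, le_nhds_ultrafilterLimit 𝓕⟩
  rw [le_principal_iff] at h𝓕
  have h' : ∀ᶠ P : BalmerSpectrum T in 𝓕, P.carrier a := by
    filter_upwards [h𝓕] with P hP using not_not.1 hP
  exact not_not.2 h'

instance : CompactSpace (Prism T) := by
  refine ⟨isCompact_iff_ultrafilter_le_nhds.2 fun 𝓕 _ => ⟨ultrafilterLimit 𝓕, trivial, ?_⟩⟩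
  have key (s : Set (BalmerSpectrum T)) (hs : IsOpen s) (hs' : IsCompact s) :
      s ∈ 𝓕 ↔ ultrafilterLimit 𝓕 ∈ s := by
    refine ⟨fun h => ?_, fun h => le_nhds_ultrafilterLimit 𝓕 (hs.mem_nhds h)⟩
    obtain ⟨Q, hQ, hQ'⟩ := isCompact_iff_ultrafilter_le_nhds.1 hs' 𝓕 (le_principal_iff.2 h)
    exact (specializes_ultrafilterLimit hQ').mem_open hs hQ
  refine le_of_le_of_eq (le_iInf₂ fun s hs => ?_) TopologicalSpace.nhds_generateFrom.symm
  obtain ⟨hP, hs | hs⟩ := hs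
  · exact le_principal_iff.2 ((key s hs.1 hs.2).2 hP)
  · refine le_principal_iff.2 ?_
    by_contra h
    exact (key sᶜ hs.1.isOpen_compl hs.2).1 (Ultrafilter.compl_mem_iff_notMem.2 h) hP

lemma isOpen_compl_supp_prism {a : T} (ha : compactObjects T a) :
    IsOpen (X := Prism T) (supp a)ᶜ :=
  (isCompact_compl_supp a).isOpen_constructibleTopology_of_isOpen (isOpen_compl_supp ha)

/-- Open down-sets of the prism are unions of supports of compact objects. -/
lemma IsOpenDownSet.exists_supp {Y : Set (Prism T)} (hY : IsOpenDownSet Y) {P : Prism T}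
    (hP : P ∈ Y) : ∃ a : T, supportedIn Y a ∧ P ∈ supp a := by
  classical
  -- A point `Q` outside the down-set `Y` is not below `P`, so some `b ∈ Q` has `P` in its support.
  -- By compactness finitely many such `b` suffice, and their tensor product is the witness.
  have hcov : Yᶜ ⊆ ⋃ b : {b : T // compactObjects T b ∧ P ∈ supp b}, (supp b.1)ᶜ := by
    intro Q hQ
    have hQP : ¬ Q ≤ P := fun h => hQ (hY.2 h hP)
    rw [prism_le_iff] at hQP
    obtain ⟨b, hb⟩ := not_forall.1 hQP
    obtain ⟨hbQ, hbP⟩ := Classical.not_imp.1 hb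
    exact Set.mem_iUnion.2 ⟨⟨b, BalmerSpectrum.le_compactObjects Q b hbQ, hbP⟩, not_not.2 hbQ⟩
  obtain ⟨t, ht⟩ := hY.1.isClosed_compl.isCompact.elim_finite_subcover _
    (fun b => isOpen_compl_supp_prism b.2.1) hcov
  have hfin : ∀ t : Finset {b : T // compactObjects T b ∧ P ∈ supp b},
      ∃ a : T, compactObjects T a ∧ P ∈ supp a ∧ ∀ b ∈ t, supp a ⊆ supp b.1 := by
    intro t
    induction t using Finset.induction with
    | empty => exact ⟨𝟙_ T, compactObjects_unit, (supp_unit (T := T)).ge (Set.mem_univ P), by simp⟩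
    | insert b t _ ih =>
      obtain ⟨a, ha, haP, h⟩ := ih
      refine ⟨b.1 ⊗ a, compactObjects_tensor b.2.1 ha, ?_, fun c hc => ?_⟩
      · rw [supp_tensor b.2.1 ha]
        exact ⟨b.2.2, haP⟩
      · rw [supp_tensor b.2.1 ha]
        rcases Finset.mem_insert.1 hc with rfl | hc
        · exact Set.inter_subset_left
        · exact Set.inter_subset_right.trans (h c hc)
  obtain ⟨a, ha, haP, h⟩ := hfin t
  refine ⟨a, ⟨ha, fun Q hQ => ?_⟩, haP⟩
  by_contra hQY
  obtain ⟨b, hb, hQb⟩ := Set.mem_iUnion₂.1 (ht hQY)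
  exact hQb (h b hb hQ)

end Topology

/-! ### Locality and orthogonality of torsion -/

section Gluing

lemma rightOrthogonal_supportedIn_tensor {Y : Set (Prism T)} {c L : T} (hc : compactObjects T c)
    (hL : (supportedIn Y).rightOrthogonal L) : (supportedIn Y).rightOrthogonal (c ⊗ L) := by
  intro s f hs
  obtain ⟨c', hc', ⟨_⟩, -⟩ := exists_exactPairing hc
  apply (tensorLeftHomEquiv s c c' L).symm.injective
  rw [hL ((tensorLeftHomEquiv s c c' L).symm f) (supportedIn_tensor hc' hs),
    hL ((tensorLeftHomEquiv s c c' L).symm 0) (supportedIn_tensor hc' hs)]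

/-- Being right-orthogonal to the compact objects supported on a set is a local condition. -/
lemma rightOrthogonal_supportedIn_of_subset_sUnion {𝒴 : Set (Set (Prism T))}
    (h𝒴 : ∀ Y ∈ 𝒴, IsOpenDownSet Y) {U : Set (Prism T)} (hU : U ⊆ ⋃₀ 𝒴) {L : T}
    (hL : ∀ Y ∈ 𝒴, (supportedIn Y).rightOrthogonal L) : (supportedIn U).rightOrthogonal L := by
  let Q : ObjectProperty T := fun L => ∀ Y ∈ 𝒴, (supportedIn Y).rightOrthogonal L
  have : Q.IsStableUnderShift ℤ := ⟨fun n => ⟨fun L hL Y hY =>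
    (supportedIn Y).rightOrthogonal.le_shift n _ (hL Y hY)⟩⟩
  have hJ := isThickIdeal_leftOrthogonal Q fun c L hc hL Y hY =>
    rightOrthogonal_supportedIn_tensor hc (hL Y hY)
  intro a f ha
  -- Otherwise some prime `P ∈ supp a` contains the whole ideal; but `P` lies in some `Y`, hence in
  -- the support of some `b` supported in `Y`, and such a `b` is in the ideal.
  have hJa : (compactObjects T ⊓ Q.leftOrthogonal) a := by
    by_contra h
    obtain ⟨P, hP, haP⟩ := hJ.exists_prime ha.1 h
    obtain ⟨Y, hY, hPY⟩ := hU (ha.2 haP)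
    obtain ⟨b, hb, hbP⟩ := (h𝒴 Y hY).exists_supp hPY
    exact hbP (hP b ⟨hb.1, fun L f hL => hL Y hY f hb⟩)
  exact hJa.2 f hL

/-- For compact `a` supported in `W`, the objects killed by `a ⊗ -` form a localizing ideal
containing the compact objects supported in `V`, by disjointness of supports. Rigidity turns `a ⊗ X
= 0` into `Hom(a, X) = 0`. -/
lemma torsion_le_localAway {V W : Set (Prism T)} (h : Disjoint V W) :
    torsion V ≤ localAway W := by
  rw [localAway_eq]
  intro X hX a f ha
  obtain ⟨a', -, ⟨_⟩, -⟩ := exists_exactPairing ha.1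
  refine eq_zero_of_isZero_tensor (b' := a') ?_ f
  have hZ := isLocalizing_leftOrthogonal (⊤ : ObjectProperty T)
  have := hZ.isClosedUnderIsomorphisms
  have hloc := isLocalizing_inverseImage_tensorLeft a hZ
  have hX' := hX _ ⟨hloc.isTriangulated, hloc.isClosedUnderIsomorphisms,
    hloc.isClosedUnderCoproducts, fun Z Y hY => ?_⟩ fun b hb => ?_
  · exact (IsZero.iff_id_eq_zero _).2 (hX' _ trivial)
  · have hY₀ : IsZero (a ⊗ Y) := (IsZero.iff_id_eq_zero _).2 (hY _ trivial)
    intro M f _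
    refine IsZero.eq_of_src ?_ f 0
    exact (isZero_tensor Z hY₀).of_iso
      ((α_ a Z Y).symm ≪≫ whiskerRightIso (β_ a Z) Y ≪≫ α_ Z a Y)
  · intro M f _
    refine (isZero_of_supp_eq_empty (compactObjects_tensor ha.1 hb.1) ?_).eq_of_src f 0
    rw [supp_tensor ha.1 hb.1]
    exact (h.symm.mono ha.2 hb.2).inter_eq

end Gluing

/-- Needed to form coproducts over points of `U`. A prime is determined by its members among small
representatives of the compact objects. -/
instance : Small.{v} (BalmerSpectrum T) := by
  obtain ⟨Q, hQ, hQc, hcQ⟩ := ObjectProperty.EssentiallySmall.exists_small_le.{v} (compactObjects T)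
  have : Small.{v} (Subtype Q) := hQ
  refine small_of_injective (β := Set (Subtype Q)) (f := fun P => {a | P.carrier a.1})
    fun P P' h => ?_
  have key (P P' : BalmerSpectrum T)
      (h : {a : Subtype Q | P.carrier a.1} = {a : Subtype Q | P'.carrier a.1}) :
      P.carrier ≤ P'.carrier := by
    intro a ha
    obtain ⟨b, hb, ⟨e⟩⟩ := hcQ a (P.le_compactObjects a ha)
    have := P.isStableUnderRetracts
    have := P'.isStableUnderRetracts
    have hb' : (⟨b, hb⟩ : Subtype Q) ∈ {a : Subtype Q | P.carrier a.1} :=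
      P.carrier.prop_of_iso e ha
    rw [h] at hb'
    exact P'.carrier.prop_of_iso e.symm hb'
  exact BalmerSpectrum.ext (le_antisymm (key P P' h) (key P' P h.symm))

instance : Small.{v} (Prism T) :=
  inferInstanceAs (Small.{v} (BalmerSpectrum T))

end TTGeometry

namespace TTGeometry

/-! ### Units, counits and exactness of adjoints -/

section Adjunction

variable {T : Type u} [Category.{v} T]

lemma isColocal_counit {A : ObjectProperty T} {R : T ⥤ A.FullSubcategory} (adj : A.ι ⊣ R) (X : T) :
    A.isColocal (adj.counit.app X) := by
  intro Y hY
  have : (fun f : Y ⟶ (R.obj X).obj => f ≫ adj.counit.app X) =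
      fun f => (adj.homEquiv ⟨Y, hY⟩ X).symm (A.fullyFaithfulι.homEquiv.symm f) := by
    ext f
    rw [Adjunction.homEquiv_counit]
    rfl
  exact this ▸ ((A.fullyFaithfulι.homEquiv (X := ⟨Y, hY⟩) (Y := R.obj X)).symm.trans
    (adj.homEquiv ⟨Y, hY⟩ X).symm).bijective

lemma isLocal_unit {A : ObjectProperty T} {L : T ⥤ A.FullSubcategory} (adj : L ⊣ A.ι) (X : T) :
    A.isLocal (adj.unit.app X) := by
  intro Y hY
  have : (fun f : (L.obj X).obj ⟶ Y => adj.unit.app X ≫ f) =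
      fun f => adj.homEquiv X ⟨Y, hY⟩ (A.fullyFaithfulι.homEquiv.symm f) := by
    ext f
    rw [Adjunction.homEquiv_unit]
    rfl
  exact this ▸ ((A.fullyFaithfulι.homEquiv (X := L.obj X) (Y := ⟨Y, hY⟩)).symm.trans
    (adj.homEquiv X ⟨Y, hY⟩)).bijective

end Adjunction

section Exactness

variable {C D E : Type*} [Category* C] [Category* D] [Category* E]
  [HasZeroObject C] [HasZeroObject D] [HasZeroObject E]
  [HasShift C ℤ] [HasShift D ℤ] [HasShift E ℤ] [Preadditive C] [Preadditive D] [Preadditive E]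
  [∀ n : ℤ, (shiftFunctor C n).Additive] [∀ n : ℤ, (shiftFunctor D n).Additive]
  [∀ n : ℤ, (shiftFunctor E n).Additive]
  [Pretriangulated C] [Pretriangulated D] [Pretriangulated E]

lemma IsExact.comp {F : C ⥤ D} {G : D ⥤ E} (hF : IsExact F) (hG : IsExact G) :
    IsExact (F ⋙ G) := by
  obtain ⟨_, _⟩ := hF
  obtain ⟨_, _⟩ := hG
  exact ⟨inferInstance, inferInstance⟩

lemma IsExact.rightAdjoint {F : C ⥤ D} (hF : IsExact F) {G : D ⥤ C} (adj : F ⊣ G) :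
    IsExact G := by
  obtain ⟨_, _⟩ := hF
  let := adj.rightAdjointCommShift ℤ
  have := adj.commShift_of_leftAdjoint ℤ
  exact ⟨inferInstance, adj.isTriangulated_rightAdjoint⟩

lemma IsExact.leftAdjoint {G : D ⥤ C} (hG : IsExact G) {F : C ⥤ D} (adj : F ⊣ G) :
    IsExact F := by
  obtain ⟨_, _⟩ := hG
  let := adj.leftAdjointCommShift ℤ
  have := adj.commShift_of_rightAdjoint ℤ
  exact ⟨inferInstance, adj.isTriangulated_leftAdjoint⟩

lemma isExact_ι (A : ObjectProperty C) [A.IsTriangulated] : IsExact A.ι :=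
  ⟨inferInstance, inferInstance⟩

end Exactness

variable {T : Type u} [Category.{v} T] [Preadditive T] [HasZeroObject T] [HasShift T ℤ]
  [∀ n : ℤ, (shiftFunctor T n).Additive] [Pretriangulated T]
  [MonoidalCategory T] [SymmetricCategory T]

instance (V : Set (Prism T)) : (localAway V).IsTriangulated :=
  inferInstanceAs (torsion V).rightOrthogonal.IsTriangulated

instance (V : Set (Prism T)) : (localAway V).IsClosedUnderIsomorphisms :=
  inferInstanceAs (torsion V).rightOrthogonal.IsClosedUnderIsomorphisms

lemma isExact_pointFunctor (W V : Set (Prism T)) (hW : (torsion W).ι.IsLeftAdjoint)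
    (hV : (localAway V).ι.IsRightAdjoint) : IsExact (pointFunctor W V hW hV) :=
  ((isExact_ι (localAway V)).leftAdjoint (Adjunction.ofIsRightAdjoint _)).comp
    ((isExact_ι (localAway V)).comp
      (((isExact_ι (torsion W)).rightAdjoint (Adjunction.ofIsLeftAdjoint _)).comp
        (isExact_ι (torsion W))))

variable [HasCoproducts.{v} T] [RigidlyCompactlyGenerated T]

/-- The localization away from `V` does not change morphisms from objects with support disjoint
from `V`. -/
lemma isColocal_unit_of_disjoint {V Z : Set (Prism T)} (h : Disjoint V Z)
    {L : T ⥤ (localAway V).FullSubcategory} (adj : L ⊣ (localAway V).ι) (X : T) :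
    (supportedIn Z).isColocal (adj.unit.app X) := by
  obtain ⟨H, L', π, η, k, hT, hH, hL'⟩ := exists_localization_triangle V X
  have hη : (localAway V).isLocal η := trW_le_isLocal_rightOrthogonal _ hT hH
  -- The unit agrees up to the isomorphism `a` with `η`, whose fibre `H` is `V`-torsion and so
  -- invisible to objects supported in `Z`.
  obtain ⟨a, ha⟩ := (hη _ (L.obj X).property).2 (adj.unit.app X)
  have ha' : (localAway V).isLocal a :=
    (localAway V).isLocal.of_precomp η a hη (by
      have := isLocal_unit adj X
      rwa [← ha] at this)
  have : IsIso a := (ObjectProperty.isLocal_iff_isIso _ a hL' (L.obj X).property).1 ha'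
  rw [← ha]
  refine (supportedIn Z).isColocal.comp_mem _ _ ?_ (ObjectProperty.isColocal_of_isIso _ a)
  refine trW_rightOrthogonal_le_isColocal _ _ (ObjectProperty.trW.mk' _ hT ?_)
  exact (localAway_eq Z).le _ (torsion_le_localAway h _ hH)

/-! ### Independence of the presentation of a point -/

section PointFunctor

variable {W V : Set (Prism T)} {x : Prism T}

/-- For a minimal isolated point `x` with `{x} = W ∩ Vᶜ`, the `x`-torsion of an object is also the
`W`-torsion of its localization away from `V`. -/
lemma isColocal_counit_comp_unit (hV : IsOpenDownSet V) (hx : IsOpenDownSet {x})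
    (h : W ∩ Vᶜ = {x}) {R : T ⥤ (torsion {x}).FullSubcategory} (adj : (torsion {x}).ι ⊣ R)
    {L : T ⥤ (localAway V).FullSubcategory} (adj' : L ⊣ (localAway V).ι) (X : T) :
    (torsion W).isColocal (adj.counit.app X ≫ adj'.unit.app X) := by
  have hxV : Disjoint {x} V := by
    rw [Set.disjoint_singleton_left]
    exact (h.ge rfl : x ∈ W ∩ Vᶜ).2
  rw [isColocal_torsion]
  refine trW_rightOrthogonal_le_isColocal _ _ ?_
  obtain ⟨C, g, k, hT⟩ := distinguished_cocone_triangle (adj.counit.app X ≫ adj'.unit.app X)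
  refine ⟨C, g, k, hT, ?_⟩
  -- On `{x}` both factors of the composite are colocal; on `V` both its source and its target are
  -- already right-orthogonal.
  refine rightOrthogonal_supportedIn_of_subset_sUnion (𝒴 := {{x}, V}) ?_ ?_ ?_
  · rintro Y (rfl | rfl)
    exacts [hx, hV]
  · intro y hy
    by_cases hyV : y ∈ V
    · exact ⟨V, by simp, hyV⟩
    · exact ⟨{x}, by simp, h.le ⟨hy, hyV⟩⟩
  · rintro Y (rfl | rfl)
    · have hcol : (supportedIn {x}).isColocal (adj.counit.app X ≫ adj'.unit.app X) := by
        refine (supportedIn {x}).isColocal.comp_mem _ _ ?_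
          (isColocal_unit_of_disjoint hxV.symm adj' X)
        rw [← isColocal_torsion]
        exact isColocal_counit adj X
      exact (ObjectProperty.trW_iff_of_distinguished _ _ hT).1
        (isColocal_le_trW_rightOrthogonal _ _ hcol)
    · rw [← localAway_eq]
      exact (localAway Y).ext_of_isTriangulatedClosed₃ _ hT
        (torsion_le_localAway hxV _ (R.obj X).property) (L.obj X).property

/-- For a minimal isolated point `x`, the functor `Γ_W L_V` with `{x} = W ∩ Vᶜ` is the
colocalization with respect to `T({x})`. -/
lemma exists_pointFunctor_counit (hV : IsOpenDownSet V) (hx : IsOpenDownSet {x})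
    (h : W ∩ Vᶜ = {x}) (hΓ : (torsion W).ι.IsLeftAdjoint)
    (hL : (localAway V).ι.IsRightAdjoint) :
    ∃ τ : pointFunctor W V hΓ hL ⟶ 𝟭 T, ∀ X,
      torsion {x} ((pointFunctor W V hΓ hL).obj X) ∧ (torsion {x}).isColocal (τ.app X) := by
  have := isLeftAdjoint_torsion_ι {x}
  let adj := Adjunction.ofIsLeftAdjoint (torsion {x}).ι
  let adj' := Adjunction.ofIsRightAdjoint (localAway V).ι
  let adjW := Adjunction.ofIsLeftAdjoint (torsion W).ι
  let Γ := (torsion {x}).ι.rightAdjoint ⋙ (torsion {x}).ι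
  let Λ := (localAway V).ι.leftAdjoint ⋙ (localAway V).ι
  let θ : Γ ⟶ Λ := adj.counit ≫ adj'.unit
  let κ : pointFunctor W V hΓ hL ⟶ Λ := Functor.whiskerLeft Λ adjW.counit
  have hθ (X : T) : (torsion W).isColocal (θ.app X) :=
    isColocal_counit_comp_unit hV hx h adj adj' X
  have hκ (X : T) : (torsion W).isColocal (κ.app X) := isColocal_counit adjW _
  have hxW : {x} ⊆ W := by rw [← h]; exact Set.inter_subset_left
  have hpt (X : T) : torsion W ((pointFunctor W V hΓ hL).obj X) :=
    (((torsion W).ι.rightAdjoint).obj (Λ.obj X)).property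
  have hΓW (X : T) : torsion W (Γ.obj X) :=
    torsion_mono hxW _ ((torsion {x}).ι.rightAdjoint.obj X).property
  -- Both `θ` and `κ` are `W`-colocal maps to `Λ X` from `W`-torsion objects, so they differ by a
  -- unique isomorphism.
  choose μ hμ using fun X => (hθ X _ (hpt X)).2 (κ.app X)
  have hiso (X : T) : IsIso (μ X) := by
    refine (ObjectProperty.isColocal_iff_isIso _ (μ X) (hpt X) (hΓW X)).1 ?_
    refine (torsion W).isColocal.of_postcomp (μ X) (θ.app X) (hθ X) ?_
    have := hκ X
    rwa [← hμ] at this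
  let ν : pointFunctor W V hΓ hL ⟶ Γ :=
    { app := μ
      naturality := fun X Y f => (hθ Y _ (hpt X)).1 (by
        dsimp only at hμ ⊢
        rw [Category.assoc, Category.assoc, hμ, NatTrans.naturality, NatTrans.naturality,
          reassoc_of% (hμ X)]) }
  refine ⟨ν ≫ adj.counit, fun X => ⟨?_, ?_⟩⟩
  · exact (torsion {x}).prop_of_iso (asIso (μ X)).symm
      ((torsion {x}).ι.rightAdjoint.obj X).property
  · exact (torsion {x}).isColocal.comp_mem _ _ (ObjectProperty.isColocal_of_isIso _ (μ X))
      (isColocal_counit adj X)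

end PointFunctor

/-! ### Splitting torsion objects over points -/

section Decomposition

variable {J : Type v} {x : J → Prism T} {F : J → T}

/-- A morphism from a compact object supported at a point to a coproduct of objects that are
torsion at distinct points factors through the summand belonging to that point. -/
lemma eq_comp_cofanProj_comp_inj (hx : Function.Injective x) (hF : ∀ j, torsion {x j} (F j))
    {c : Cofan F} (hc : IsColimit c) (j : J) {s : T} (hs : supportedIn {x j} s) (g : s ⟶ c.pt) :
    g = g ≫ cofanProj hc j ≫ c.inj j := by
  rw [← sub_eq_zero]
  refine eq_zero_of_mem_finiteSums hc (mem_finiteSums_of_compactObjects hs.1 hc _) fun i => ?_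
  rw [Preadditive.sub_comp, Category.assoc, Category.assoc]
  by_cases hij : i = j
  · subst hij
    rw [inj_cofanProj_self, Category.comp_id, sub_self]
  · rw [inj_cofanProj_of_ne hc (Ne.symm hij), comp_zero, comp_zero, sub_zero]
    have hdisj : Disjoint ({x i} : Set (Prism T)) {x j} := by
      rw [Set.disjoint_singleton]
      exact fun h => hij (hx h)
    exact torsion_le_localAway hdisj _ (hF i) _ (supportedIn_le_torsion _ _ hs)

lemma isColocal_inj (hx : Function.Injective x) (hF : ∀ j, torsion {x j} (F j))
    {c : Cofan F} (hc : IsColimit c) (j : J) : (torsion {x j}).isColocal (c.inj j) := by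
  rw [isColocal_torsion]
  refine fun s hs => ⟨fun f g hfg => ?_, fun g =>
    ⟨g ≫ cofanProj hc j, ?_⟩⟩
  · have := congrArg (· ≫ cofanProj hc j) hfg
    simpa using this
  · dsimp only
    rw [Category.assoc]
    exact (eq_comp_cofanProj_comp_inj hx hF hc j hs g).symm

/-- A torsion object over a discrete set of minimal points is the coproduct of its torsion parts
at these points. -/
lemma isIso_desc (hx : Function.Injective x) (hxo : ∀ j, IsOpenDownSet {x j})
    (hF : ∀ j, torsion {x j} (F j)) {c : Cofan F} (hc : IsColimit c)
    {M : T} (hM : torsion (Set.range x) M) (f : ∀ j, F j ⟶ M)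
    (hf : ∀ j, (torsion {x j}).isColocal (f j)) : IsIso (Cofan.IsColimit.desc hc f) := by
  have hpt : torsion (Set.range x) c.pt := (isLocalizing_torsion _).prop_cofan hc fun j =>
    torsion_mono (Set.singleton_subset_iff.2 (Set.mem_range_self j)) _ (hF j)
  refine (ObjectProperty.isColocal_iff_isIso _ _ hpt hM).1 ?_
  rw [isColocal_torsion]
  obtain ⟨C, g, k, hT⟩ := distinguished_cocone_triangle (Cofan.IsColimit.desc hc f)
  refine trW_rightOrthogonal_le_isColocal _ _ ⟨C, g, k, hT, ?_⟩
  -- Over each point both the inclusion of its summand and `f j` are colocal, hence so is the map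
  -- from the coproduct.
  refine rightOrthogonal_supportedIn_of_subset_sUnion (𝒴 := Set.range fun j => {x j}) ?_ ?_ ?_
  · rintro _ ⟨j, rfl⟩
    exact hxo j
  · rintro _ ⟨j, rfl⟩
    exact Set.mem_sUnion.2 ⟨{x j}, ⟨j, rfl⟩, rfl⟩
  · rintro _ ⟨j, rfl⟩
    refine (ObjectProperty.trW_iff_of_distinguished _ _ hT).1
      (isColocal_le_trW_rightOrthogonal _ _ ?_)
    rw [← isColocal_torsion]
    refine (torsion {x j}).isColocal.of_precomp (c.inj j) (Cofan.IsColimit.desc hc f)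
      (isColocal_inj hx hF hc j) ?_
    have : c.inj j ≫ Cofan.IsColimit.desc hc f = f j := Cofan.IsColimit.fac hc f j
    rw [this]
    exact hf j

end Decomposition

/-! ### The product decomposition -/

section Equivalence

lemma isIso_of_isColocal_torsion {Y : Set (Prism T)} {X X' : T} {f : X ⟶ X'}
    (hf : (torsion Y).isColocal f) (hX : torsion Y X) (hX' : torsion Y X') : IsIso f :=
  (ObjectProperty.isColocal_iff_isIso _ _ hX hX').1 hf

variable {U : Set (Prism T)} {G : U → T ⥤ T} (τ : ∀ x, G x ⟶ 𝟭 T)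

lemma essImage_eq_torsion (hG : ∀ (x : U) X, torsion {x.1} ((G x).obj X))
    (hτ : ∀ (x : U) X, (torsion {x.1}).isColocal ((τ x).app X)) (x : U) :
    (G x).essImage = torsion {x.1} := by
  ext X
  constructor
  · rintro ⟨Y, ⟨e⟩⟩
    exact (torsion {x.1}).prop_of_iso e (hG x Y)
  · intro hX
    have := isIso_of_isColocal_torsion (hτ x X) (hG x X) hX
    exact ⟨X, ⟨asIso ((τ x).app X)⟩⟩

/-- `M` is the coproduct of the `G x M` along `τ`. Existence will give fullness, uniqueness
faithfulness. -/
lemma exists_unique_hom (hU : ∀ x ∈ U, IsOpenDownSet {x})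
    (hG : ∀ (x : U) X, torsion {x.1} ((G x).obj X))
    (hτ : ∀ (x : U) X, (torsion {x.1}).isColocal ((τ x).app X)) {M N : T} (hM : torsion U M)
    (φ : ∀ x, (G x).obj M ⟶ N) : ∃! f : M ⟶ N, ∀ x, (τ x).app M ≫ f = φ x := by
  let e : Shrink.{v} U ≃ U := (equivShrink U).symm
  have hc := coproductIsCoproduct fun j => (G (e j)).obj M
  have hrange : Set.range (fun j => (e j).1) = U := by
    rw [← Function.comp_def Subtype.val, e.surjective.range_comp, Subtype.range_val]
  let d := Cofan.IsColimit.desc hc fun j => (τ (e j)).app M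
  have hd (j) : Sigma.ι (fun j => (G (e j)).obj M) j ≫ d = (τ (e j)).app M :=
    Cofan.IsColimit.fac hc _ _
  have : IsIso d := isIso_desc (x := fun j => (e j).1)
    (Subtype.val_injective.comp e.injective) (fun j => hU _ (e j).2) (fun j => hG _ _) hc
    (by rwa [hrange]) _ fun j => hτ _ _
  have key (f : M ⟶ N) : (∀ x, (τ x).app M ≫ f = φ x) ↔ d ≫ f = Sigma.desc fun j => φ (e j) := by
    rw [← e.forall_congr_right]
    constructor
    · intro h
      refine Sigma.hom_ext _ _ fun j => ?_
      rw [← Category.assoc, hd, h, Sigma.ι_desc]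
    · intro h j
      rw [← hd, Category.assoc, h, Sigma.ι_desc]
  refine ⟨inv d ≫ Sigma.desc fun j => φ (e j), (key _).2 (by simp), fun f hf => ?_⟩
  rw [← (key f).1 hf, IsIso.inv_hom_id_assoc]

/-- The torsion category over a set of isolated minimal points is the product of the torsion
categories at these points. -/
lemma isEquivalence_pi' (hU : ∀ x ∈ U, IsOpenDownSet {x})
    (hG : ∀ (x : U) X, torsion {x.1} ((G x).obj X))
    (hτ : ∀ (x : U) X, (torsion {x.1}).isColocal ((τ x).app X)) :
    (Functor.pi' fun x => (torsion U).ι ⋙ (G x).toEssImage).IsEquivalence := by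
  have faithful : (Functor.pi' fun x => (torsion U).ι ⋙ (G x).toEssImage).Faithful := by
    refine ⟨fun {M N} f g hfg => ?_⟩
    have hx (x : U) : (G x).map f.hom = (G x).map g.hom :=
      congrArg (fun k => (k x).hom) hfg
    ext
    refine (exists_unique_hom τ hU hG hτ M.property
      fun x => (τ x).app M.obj ≫ g.hom).unique (fun x => ?_) fun _ => rfl
    rw [← Functor.id_map f.hom, ← (τ x).naturality, hx, (τ x).naturality, Functor.id_map]
  have full : (Functor.pi' fun x => (torsion U).ι ⋙ (G x).toEssImage).Full := by
    refine ⟨fun {M N} φ => ?_⟩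
    obtain ⟨f, hf, -⟩ := exists_unique_hom τ hU hG hτ M.property
      fun x => (φ x).hom ≫ (τ x).app N.obj
    refine ⟨ObjectProperty.homMk f, funext fun x => ?_⟩
    ext
    refine (hτ x N.obj _ (hG x M.obj)).1 ?_
    exact ((τ x).naturality f).trans (hf x)
  have essSurj : (Functor.pi' fun x => (torsion U).ι ⋙ (G x).toEssImage).EssSurj := by
    refine ⟨fun N => ?_⟩
    let e : Shrink.{v} U ≃ U := (equivShrink U).symm
    have hN (x : U) : torsion {x.1} (N x).obj := by
      rw [← essImage_eq_torsion τ hG hτ x]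
      exact (N x).property
    have hc := coproductIsCoproduct fun j => (N (e j)).obj
    have hinj (x : U) : ∃ i : (N x).obj ⟶ ∐ fun j => (N (e j)).obj,
        (torsion {x.1}).isColocal i := by
      obtain ⟨j, rfl⟩ := e.surjective x
      exact ⟨_, isColocal_inj (x := fun j => (e j).1)
        (Subtype.val_injective.comp e.injective) (fun j => hN (e j)) hc j⟩
    have hM : torsion U (∐ fun j => (N (e j)).obj) :=
      (isLocalizing_torsion U).prop_cofan hc fun j =>
        torsion_mono (Set.singleton_subset_iff.2 (e j).2) _ (hN (e j))
    -- The summand at `x` and `G x` of the coproduct are both `x`-torsion with colocal maps to the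
    -- coproduct.
    have hiso (x : U) : Nonempty ((G x).obj (∐ fun j => (N (e j)).obj) ≅ (N x).obj) := by
      obtain ⟨i, hi⟩ := hinj x
      obtain ⟨k, hk⟩ := (hi _ (hG x _)).2 ((τ x).app _)
      have hk' : (torsion {x.1}).isColocal k :=
        (torsion {x.1}).isColocal.of_postcomp k i hi (by
          dsimp only at hk
          rw [hk]
          exact hτ x _)
      have := isIso_of_isColocal_torsion hk' (hG x _) (hN x)
      exact ⟨asIso k⟩
    exact ⟨⟨_, hM⟩, ⟨Pi.isoMk fun x => (G x).essImage.isoMk (hiso x).some⟩⟩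
  exact { faithful := faithful, full := full, essSurj := essSurj }

end Equivalence

end TTGeometry

open TTGeometry
theorem proposition5p9 (T : Type u) [Category.{v} T]
    [Preadditive T] [HasZeroObject T]
    [HasShift T ℤ]
    [∀ n : ℤ, (shiftFunctor T n).Additive]
    [Pretriangulated T] [IsTriangulated T]
    [MonoidalCategory T] [SymmetricCategory T]
    [HasCoproducts.{v} T] [RigidlyCompactlyGenerated T]
    (U : Set (Prism T)) (hU : ∀ x ∈ U, IsOpen {x} ∧ IsMin x) :
    -- the functors `Γ_W` and `L_V` exist for all open down-sets `W` and `V`, and `U` is one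
    ∃ (hΓ : ∀ W : Set (Prism T), IsOpenDownSet W →
          (torsion W).ι.IsLeftAdjoint)
      (hL : ∀ V : Set (Prism T), IsOpenDownSet V →
          (localAway V).ι.IsRightAdjoint),
      IsOpenDownSet U ∧
      -- every `x ∈ U` has a presentation `{x} = W ∩ Vᶜ`
      (∀ x ∈ U, ∃ W V : Set (Prism T), IsOpenDownSet W ∧
        IsOpenDownSet V ∧ W ∩ Vᶜ = {x}) ∧
      -- for all choices of such presentations, the canonical functor is an exact equivalence
      ∀ (W V : U → Set (Prism T))
        (hW : ∀ x, IsOpenDownSet (W x)) (hV : ∀ x, IsOpenDownSet (V x))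
        (_ : ∀ x, W x ∩ (V x)ᶜ = {(x : Prism T)}),
        (diagonalFunctor U W V (fun x => hΓ _ (hW x))
          (fun x => hL _ (hV x))).IsEquivalence ∧
        ∀ x : U,
          (pointFunctor (W x) (V x) (hΓ _ (hW x)) (hL _ (hV x))).essImage.IsTriangulated ∧
          IsExact ((torsion U).ι ⋙
            pointFunctor (W x) (V x) (hΓ _ (hW x)) (hL _ (hV x))) := by
  have hU' : ∀ x ∈ U, IsOpenDownSet {x} := fun x hx =>
    ⟨(hU x hx).1, fun a b hba ha => (hU x hx).2.eq_of_le (hba.trans_eq ha)⟩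
  refine ⟨fun W _ => isLeftAdjoint_torsion_ι W, fun V _ => isRightAdjoint_localAway_ι V,
    ⟨?_, fun a b hba ha => (hU a ha).2.eq_of_le hba ▸ ha⟩,
    fun x hx => ⟨{x}, ∅, hU' x hx, ⟨isOpen_empty, isLowerSet_empty⟩, by simp⟩,
    fun W V hW hV h => ?_⟩
  · rw [← Set.biUnion_of_singleton U]
    exact isOpen_biUnion fun x hx => (hU x hx).1
  · choose τ hG hτ using fun x : U => by
      simpa only [forall_and] using exists_pointFunctor_counit (hV x) (hU' x x.2) (h x)
        (isLeftAdjoint_torsion_ι (W x)) (isRightAdjoint_localAway_ι (V x))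
    refine ⟨isEquivalence_pi' τ hU' hG hτ, fun x => ⟨?_, (isExact_ι _).comp
      (isExact_pointFunctor _ _ _ _)⟩⟩
    rw [essImage_eq_torsion τ hG hτ x]
    infer_instance
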